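/- **Setting.** Let $\mathcal X\subseteq\mathbb R^p$, $\mathcal Y\subseteq\mathbb R^d$ be nonempty, convex, closed and bounded, $\mathcal Z=\mathcal X\times\mathcal Y$, $z=(x,y)$, and let $f,g$ be real-valued and continuously differentiable near $\mathcal Z$. Assume that for constants $\rho_f>0$, $\rho_g\ge 0$ and all $z=(x,y),z'=(x',y')\in\mathcal Z$: $\|\nabla f(z)-\nabla f(z')\|\le\rho_f\|z-z'\|$; $\|\nabla g(z)-\nabla g(z')\|\le\rho_g\|z-z'\|$; $g(x,\cdot)$ is convex on $\mathcal Y$; and $g(x',y')\ge g(x,y)+\langle\nabla_xg(x,y),x'-x\rangle+\langle\nabla_yg(x,y),y'-y\rangle-\frac{\rho_g}{2}\|x-x'\|^2$. ($f$ may be nonconvex.) Let $\alpha,\delta>0$, $\tilde g(x,y)=g(x,y)+\frac\alpha2\|y\|^2$, $\tilde g^*(x)=\min_{y\in\mathcal Y}\tilde g(x,y)$, and consider the reformulated problem $$\min_{z\in\mathcal Z} f(z)\quad\text{s.t.}\quad \tilde h(z):=g(z)-\tilde g^*(x)-\delta\le 0. \tag{R}$$ A random $\hat z\in\mathcal Z$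 is a *stochastic $\epsilon$-KKT point* of (R) if there are random $z\in\mathcal Z$, $\lambda\ge0$ with $\tilde h(z)\le0$ such that $\mathbb E\|z-\hat z\|^2\le\epsilon$, $\mathbb E|\lambda\tilde h(z)|\le\epsilon$ and $\mathbb E\,\mathrm{dist}\big(\nabla f(z)+\lambda\nabla\tilde h(z),-\mathcal N(z;\mathcal Z)\big)^2\le\epsilon$, where $\mathcal N(z;\mathcal Z)$ is the normal cone to $\mathcal Z$ at $z$. **Algorithm (Proximal-PDBO).** Let $\rho=\frac{2\alpha\rho_g+\rho_g^2}{2\alpha}$ and let $\Pi_S$ be the Euclidean projection onto $S$. Given $B,K,T,N$, sequences $\eta_t,\tau_t,\theta_t,\gamma_t$ and $\tilde z_0\in\mathcal Z$, for $k=1,\dots,K$: set $z_0=\tilde z_{k-1}$, $\lambda_0=0$; for $t=0,\dots,T-1$, starting from any $\hat y_0\in\mathcal Y$ do $N$ steps $\hat y_{n+1}=\Pi_{\mathcal Y}\big(\hat y_n-\frac{2}{\rho_g+2\alpha}(\nabla_yg(x_t,\hat y_n)+\alpha\hat y_n)\big)$, put $$\hat h_k(z_t)=g(z_t)-\tilde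 g(x_t,\hat y_N)-\delta+\rho\|x_t-\tilde x_{k-1}\|^2,\qquad \hat\nabla\tilde h_k(z_t)=\nabla g(z_t)-(\nabla_xg(x_t,\hat y_N);0)+2\rho(x_t-\tilde x_{k-1};0),$$ and update, with $\hat h_k(z_{-1}):=\hat h_k(z_0)$, $$\lambda_{t+1}=\Pi_{[0,B]}\Big(\lambda_t+\tfrac1{\tau_t}\big((1+\theta_t)\hat h_k(z_t)-\theta_t\hat h_k(z_{t-1})\big)\Big),$$ $$z_{t+1}=\Pi_{\mathcal Z}\Big(z_t-\tfrac1{\eta_t}\big(\nabla f(z_t)+2\rho_f(z_t-\tilde z_{k-1})+\lambda_{t+1}\hat\nabla\tilde h_k(z_t)\big)\Big).$$ Then set $\tilde z_k=\frac{1}{\Gamma_T}\sum_{t<T}\gamma_tz_{t+1}$ with $\Gamma_T=\sum_{t<T}\gamma_t$. Finally draw $\hat k$ uniformly from $\{1,\dots,K\}$ and output $\tilde z_{\hat k}$. **Theorem.** Let $D_{\mathcal Z}=\sup_{z,z'\in\mathcal Z}\|z-z'\|$, $D_f=\sup_{z,z'\in\mathcal Z}|f(z)-f(z')|$, $L_g=\sup_{z\in\mathcal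 Z}\|\nabla g(z)\|$, $\rho_h=\rho_g(2+\rho_g/\alpha)$. Let $B\ge\frac{D_f+\rho_fD_{\mathcal Z}^2}{\delta}+1$, let $L>0$ with $L\ge 2L_g+\rho_hD_{\mathcal Z}$, $t_0=\frac{6\rho_f+4B\rho_h}{\rho_f}$, and $$\gamma_t=t+t_0+1,\quad \eta_t=\frac{\rho_f(t+t_0+1)}2,\quad \theta_t=\frac{t+t_0}{t+t_0+1},\quad \tau_t=\frac{4L^2}{\rho_f t}\ (t\ge1),\quad \tau_0>0\text{ arbitrary}.$$ Then there is a constant $C$ independent of $K,T,N$, of $\tilde z_0$ and of the initial points $\hat y_0$, such that for all $K,T\ge1$, $N\ge0$ the output $\tilde z_{\hat k}$ is a stochastic $\epsilon$-KKT point of (R) with $$\epsilon=C\Big(\frac1K+\frac1{T^2}+\Big(1-\frac{\alpha}{\rho_g+2\alpha}\Big)^N\Big).$$ -/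

import Mathlib

open MeasureTheory
open scoped Pointwise RealInnerProductSpace

noncomputable section

/-- `ℝⁿ` with the Euclidean norm. -/
abbrev Vec (n : ℕ) : Type := EuclideanSpace ℝ (Fin n)

/-- `ℝᵖ × ℝᵈ` with the Euclidean norm `‖(x, y)‖² = ‖x‖² + ‖y‖²`. -/
abbrev PairSpace (p d : ℕ) : Type := WithLp 2 (Vec p × Vec d)

/-- The pair `z = (x, y)`. -/
def pair {p d : ℕ} (x : Vec p) (y : Vec d) : PairSpace p d := WithLp.toLp 2 (x, y)

/-- A nearest point of `S` to `v`: the Euclidean projection when `S` is nonempty, closed and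
convex, where the nearest point exists and is unique. -/
def proj {E : Type*} [NormedAddCommGroup E] (S : Set E) (v : E) : E :=
  Classical.epsilon fun w => w ∈ S ∧ ∀ u ∈ S, ‖v - w‖ ≤ ‖v - u‖

/-- The normal cone of `S` at `z`. -/
def normalCone {E : Type*} [NormedAddCommGroup E] [InnerProductSpace ℝ E] (S : Set E) (z : E) :
    Set E :=
  {v | ∀ w ∈ S, ⟪v, w - z⟫ ≤ 0}

/-- The data of a bilevel problem `min f(x, y)` over `x ∈ X`, `y ∈ argmin_{y ∈ Y} g(x, y)`,
with the smoothing parameter `α` and the relaxation parameter `δ` of its reformulation. -/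
structure BilevelProblem (p d : ℕ) where
  X : Set (Vec p)
  Y : Set (Vec d)
  f : PairSpace p d → ℝ
  g : PairSpace p d → ℝ
  α : ℝ
  δ : ℝ

namespace BilevelProblem

variable {p d : ℕ} (P : BilevelProblem p d)

/-- `Z = X × Y`. -/
def Z : Set (PairSpace p d) := {z | z.fst ∈ P.X ∧ z.snd ∈ P.Y}

/-- The setting: `X` and `Y` are nonempty, convex, closed and bounded, `α, δ > 0`, and `f`, `g` are
continuously differentiable (in a neighbourhood of every point of `X × Y`). -/
structure Setting : Prop where
  X_nonempty : P.X.Nonempty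
  X_convex : Convex ℝ P.X
  X_closed : IsClosed P.X
  X_bounded : Bornology.IsBounded P.X
  Y_nonempty : P.Y.Nonempty
  Y_convex : Convex ℝ P.Y
  Y_closed : IsClosed P.Y
  Y_bounded : Bornology.IsBounded P.Y
  f_contDiff : ∀ z ∈ P.Z, ContDiffAt ℝ 1 P.f z
  g_contDiff : ∀ z ∈ P.Z, ContDiffAt ℝ 1 P.g z
  α_pos : 0 < P.α
  δ_pos : 0 < P.δ

/-- Gradient Lipschitz objectives, `g` convex in `y`, and the lower bound on `g` on `X × Y`. The
two components of the gradient of `g` at `z = (x, y)` are `∇ₓ g(x, y)` and `∇_y g(x, y)`. -/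
structure Assumption (ρf ρg : ℝ) : Prop where
  f_lipschitz : ∀ z ∈ P.Z, ∀ z' ∈ P.Z, ‖gradient P.f z - gradient P.f z'‖ ≤ ρf * ‖z - z'‖
  g_lipschitz : ∀ z ∈ P.Z, ∀ z' ∈ P.Z, ‖gradient P.g z - gradient P.g z'‖ ≤ ρg * ‖z - z'‖
  g_convex : ∀ x ∈ P.X, ConvexOn ℝ P.Y fun y => P.g (pair x y)
  g_lower : ∀ z ∈ P.Z, ∀ z' ∈ P.Z,
    P.g z + ⟪(gradient P.g z).fst, z'.fst - z.fst⟫ + ⟪(gradient P.g z).snd, z'.snd - z.snd⟫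
      - ρg / 2 * ‖z.fst - z'.fst‖ ^ 2 ≤ P.g z'

/-- `g̃(x, y) = g(x, y) + (α / 2) ‖y‖²`. -/
def gTilde (x : Vec p) (y : Vec d) : ℝ := P.g (pair x y) + P.α / 2 * ‖y‖ ^ 2

/-- `g̃*(x) = min_{y ∈ Y} g̃(x, y)`. -/
def gTildeStar (x : Vec p) : ℝ := sInf (P.gTilde x '' P.Y)

/-- `h̃(z) = g(z) - g̃*(x) - δ`, the constraint function of the reformulated problem
`min_{z ∈ Z} f(z)` subject to `h̃(z) ≤ 0`. -/
def hTilde (z : PairSpace p d) : ℝ := P.g z - P.gTildeStar z.fst - P.δ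

/-- `D_Z = sup_{z, z' ∈ Z} ‖z - z'‖`. -/
def diamZ : ℝ := Metric.diam P.Z

/-- `D_f = sup_{z, z' ∈ Z} |f(z) - f(z')|`. -/
def oscF : ℝ := Metric.diam (P.f '' P.Z)

/-- `L_g = sup_{z ∈ Z} ‖∇g(z)‖`. -/
def lipG : ℝ := sSup ((fun z => ‖gradient P.g z‖) '' P.Z)

/-- The proximal coefficient `ρ = (2 α ρ_g + ρ_g²) / (2 α)` of the constraint. -/
def rho (ρg : ℝ) : ℝ := (2 * P.α * ρg + ρg ^ 2) / (2 * P.α)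

/-- `ρ_h = ρ_g (2 + ρ_g / α)`. -/
def rhoH (ρg : ℝ) : ℝ := ρg * (2 + ρg / P.α)

/-- The random point `zhat` is a stochastic `ε`-KKT point of `min_{z ∈ Z} f(z)` subject to
`h̃(z) ≤ 0`: there are random `z ∈ Z`, `lam ≥ 0` with `h̃(z) ≤ 0` for which
`𝔼 ‖z - zhat‖² ≤ ε`, `𝔼 |lam h̃(z)| ≤ ε` and `𝔼 dist(∇f(z) + lam ∇h̃(z), -N(z; Z))² ≤ ε`. -/
def IsStochasticKKT {Ω : Type*} [MeasurableSpace Ω] (μ : Measure Ω)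
    (zhat : Ω → PairSpace p d) (ε : ℝ) : Prop :=
  (∀ᵐ ω ∂μ, zhat ω ∈ P.Z) ∧
  ∃ (z : Ω → PairSpace p d) (lam : Ω → ℝ),
    Measurable z ∧ Measurable lam ∧
    (∀ᵐ ω ∂μ, z ω ∈ P.Z ∧ 0 ≤ lam ω ∧ P.hTilde (z ω) ≤ 0) ∧
    (Integrable (fun ω => ‖z ω - zhat ω‖ ^ 2) μ ∧ ∫ ω, ‖z ω - zhat ω‖ ^ 2 ∂μ ≤ ε) ∧
    (Integrable (fun ω => |lam ω * P.hTilde (z ω)|) μ ∧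
      ∫ ω, |lam ω * P.hTilde (z ω)| ∂μ ≤ ε) ∧
    (Integrable (fun ω => Metric.infDist (gradient P.f (z ω) + lam ω • gradient P.hTilde (z ω))
        (-normalCone P.Z (z ω)) ^ 2) μ ∧
      ∫ ω, Metric.infDist (gradient P.f (z ω) + lam ω • gradient P.hTilde (z ω))
        (-normalCone P.Z (z ω)) ^ 2 ∂μ ≤ ε)

/-- Projected gradient descent `ŷ_0, ŷ_1, …` for `min_{y ∈ Y} g̃(x, y)` with stepsize
`2 / (ρ_g + 2 α)`. -/
def yHat (ρg : ℝ) (x : Vec p) (y0 : Vec d) : ℕ → Vec d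
  | 0 => y0
  | n + 1 =>
    let y := yHat ρg x y0 n
    proj P.Y (y - (2 / (ρg + 2 * P.α)) • ((gradient P.g (pair x y)).snd + P.α • y))

end BilevelProblem

/-- The input of Proximal-PDBO: stepsize parameters `η_t`, `τ_t` (the stepsizes are their
inverses), acceleration weights `θ_t`, output weights `γ_t`, the bound `B` of the dual interval
`Λ = [0, B]`, and the numbers `T` and `N` of primal-dual and projected gradient steps. -/
structure PDBOInput where
  η : ℕ → ℝ
  τ : ℕ → ℝ
  θ : ℕ → ℝ
  γ : ℕ → ℝ
  B : ℝ
  T : ℕ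
  N : ℕ

/-- The state of the primal-dual loop before step `t`: the iterates `z_t`, `λ_t` and the estimate
`ĥ_k(z_{t-1})`. -/
structure PDBOState (p d : ℕ) where
  z : PairSpace p d
  lam : ℝ
  hPrev : ℝ

namespace BilevelProblem

variable {p d : ℕ} (P : BilevelProblem p d)

/-- `ĥ_k(z) = g(z) - g̃(x, ŷ) - δ + ρ ‖x - x̃_{k-1}‖²`, where `c = z̃_{k-1}` and `ŷ` is the
estimate of the minimizer of `g̃(x, ·)`. -/
def hHat (ρg : ℝ) (c z : PairSpace p d) (y : Vec d) : ℝ :=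
  P.g z - P.gTilde z.fst y - P.δ + P.rho ρg * ‖z.fst - c.fst‖ ^ 2

/-- `∇̂h̃_k(z) = ∇g(z) - (∇ₓ g(x, ŷ); 0) + 2 ρ (x - x̃_{k-1}; 0)`. -/
def gradHHat (ρg : ℝ) (c z : PairSpace p d) (y : Vec d) : PairSpace p d :=
  gradient P.g z - pair (gradient P.g (pair z.fst y)).fst 0
    + (2 * P.rho ρg) • pair (z.fst - c.fst) 0

/-- `∇f_k(z) = ∇f(z) + 2 ρ_f (z - z̃_{k-1})`. -/
def gradFk (ρf : ℝ) (c z : PairSpace p d) : PairSpace p d :=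
  gradient P.f z + (2 * ρf) • (z - c)

/-- The primal-dual loop for the subproblem with proximal center `c = z̃_{k-1}`, started at
`z_0 = z_{-1} = c`, `λ_0 = 0`. Step `t` first estimates the minimizer of `g̃(x_t, ·)` by `N`
projected gradient steps from `y0 t`, then updates `λ`, then `z`. -/
def innerLoop (ρf ρg : ℝ) (A : PDBOInput) (c : PairSpace p d) (y0 : ℕ → Vec d) :
    ℕ → PDBOState p d
  | 0 => ⟨c, 0, P.hHat ρg c c (P.yHat ρg c.fst (y0 0) A.N)⟩
  | t + 1 =>
    let s := innerLoop ρf ρg A c y0 t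
    let y := P.yHat ρg s.z.fst (y0 t) A.N
    let h := P.hHat ρg c s.z y
    let lam' := proj (Set.Icc 0 A.B)
      (s.lam + 1 / A.τ t * ((1 + A.θ t) * h - A.θ t * s.hPrev))
    let z' := proj P.Z
      (s.z - (1 / A.η t) • (P.gradFk ρf c s.z + lam' • P.gradHHat ρg c s.z y))
    ⟨z', lam', h⟩

/-- The weighted average `(1 / Γ_T) ∑_{t < T} γ_t z_{t+1}`, with `Γ_T = ∑_{t < T} γ_t`. -/
def innerOutput (ρf ρg : ℝ) (A : PDBOInput) (c : PairSpace p d) (y0 : ℕ → Vec d) :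
    PairSpace p d :=
  (1 / ∑ t ∈ Finset.range A.T, A.γ t) •
    ∑ t ∈ Finset.range A.T, A.γ t • (P.innerLoop ρf ρg A c y0 (t + 1)).z

/-- The outer iterates `z̃_0, z̃_1, …` of Proximal-PDBO; `y0 k t` is the initial point of the
projected gradient descent in step `t` of outer iteration `k`. -/
def proximalPDBO (ρf ρg : ℝ) (A : PDBOInput) (z0 : PairSpace p d) (y0 : ℕ → ℕ → Vec d) :
    ℕ → PairSpace p d
  | 0 => z0
  | k + 1 => P.innerOutput ρf ρg A (proximalPDBO ρf ρg A z0 y0 k) (y0 (k + 1))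

end BilevelProblem

end

open MeasureTheory
open scoped Pointwise RealInnerProductSpace

noncomputable section

section Hilbert

variable {E : Type*} [NormedAddCommGroup E] [InnerProductSpace ℝ E]

theorem proj_spec [CompleteSpace E] {S : Set E} (hne : S.Nonempty) (hcl : IsClosed S)
    (hcv : Convex ℝ S) (v : E) :
    proj S v ∈ S ∧ ∀ u ∈ S, ⟪v - proj S v, u - proj S v⟫ ≤ 0 := by
  obtain ⟨w, hw, hmin⟩ := exists_norm_eq_iInf_of_complete_convex hne hcl.isComplete hcv v
  have hbdd : BddBelow (Set.range fun u : S => ‖v - u‖) :=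
    ⟨0, by rintro _ ⟨u, rfl⟩; exact norm_nonneg _⟩
  have hex : ∃ w, w ∈ S ∧ ∀ u ∈ S, ‖v - w‖ ≤ ‖v - u‖ :=
    ⟨w, hw, fun u hu => hmin ▸ ciInf_le hbdd (⟨u, hu⟩ : S)⟩
  have hsp : proj S v ∈ S ∧ ∀ u ∈ S, ‖v - proj S v‖ ≤ ‖v - u‖ := Classical.epsilon_spec hex
  refine ⟨hsp.1, (norm_eq_iInf_iff_real_inner_le_zero hcv hsp.1).1 ?_⟩
  have : Nonempty S := ⟨⟨w, hw⟩⟩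
  exact le_antisymm (le_ciInf fun u => hsp.2 u u.2) (ciInf_le hbdd (⟨_, hsp.1⟩ : S))

/-- The three-point inequality of a projected step. -/
theorem proj_step_inner_le [CompleteSpace E] {S : Set E} (hne : S.Nonempty) (hcl : IsClosed S)
    (hcv : Convex ℝ S) {η : ℝ} (hη : 0 < η) (z v : E) {w : E} (hw : w ∈ S) :
    ⟪v, proj S (z - (1 / η) • v) - w⟫ ≤
      η / 2 * (‖w - z‖ ^ 2 - ‖w - proj S (z - (1 / η) • v)‖ ^ 2
        - ‖proj S (z - (1 / η) • v) - z‖ ^ 2) := by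
  set u := proj S (z - (1 / η) • v) with hu
  have h := (proj_spec hne hcl hcv (z - (1 / η) • v)).2 w hw
  rw [← hu] at h
  have e1 : ⟪z - (1 / η) • v - u, w - u⟫ = ⟪z - u, w - u⟫ + 1 / η * ⟪v, u - w⟫ := by
    simp only [inner_sub_left, inner_sub_right, real_inner_smul_left]; ring
  have e2 : ‖w - z‖ ^ 2 = ‖w - u‖ ^ 2 - 2 * ⟪z - u, w - u⟫ + ‖u - z‖ ^ 2 := by
    have := norm_sub_sq_real (w - u) (z - u)
    rw [show w - u - (z - u) = w - z by abel, real_inner_comm] at this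
    rw [this, norm_sub_rev z u]
  rw [e1] at h
  have h2 : ⟪v, u - w⟫ ≤ - (η * ⟪z - u, w - u⟫) := by
    have := mul_le_mul_of_nonneg_left h hη.le
    have e : η * (⟪z - u, w - u⟫ + 1 / η * ⟪v, u - w⟫) = η * ⟪z - u, w - u⟫ + ⟪v, u - w⟫ := by
      field_simp
    linarith
  rw [e2]; linarith

/-- The descent lemma on a convex set. -/
theorem abs_sub_linearization_le [CompleteSpace E] {f : E → ℝ} {S : Set E} (hS : Convex ℝ S)
    (hd : ∀ z ∈ S, DifferentiableAt ℝ f z) {M : ℝ}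
    (hL : ∀ z ∈ S, ∀ w ∈ S, ‖gradient f z - gradient f w‖ ≤ M * ‖z - w‖) {z w : E}
    (hz : z ∈ S) (hw : w ∈ S) :
    |f w - f z - ⟪gradient f z, w - z⟫| ≤ M / 2 * ‖w - z‖ ^ 2 := by
  set v := w - z with hv
  have hmem : ∀ t ∈ Set.Icc (0 : ℝ) 1, z + t • v ∈ S := fun t ht => by
    have := hS.add_smul_sub_mem hz hw ht
    simpa [hv] using this
  have hder : ∀ t ∈ Set.Icc (0 : ℝ) 1,
      HasDerivAt (fun t : ℝ => f (z + t • v)) ⟪gradient f (z + t • v), v⟫ t := by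
    intro t ht
    have h1 := (hd _ (hmem t ht)).hasGradientAt.hasFDerivAt
    have h2 : HasDerivAt (fun t : ℝ => z + t • v) v t := by
      simpa using ((hasDerivAt_id t).smul_const v).const_add z
    exact (h1.comp_hasDerivAt t h2).congr_deriv (by simp)
  have hbound : ∀ t ∈ Set.Icc (0 : ℝ) 1,
      |⟪gradient f (z + t • v), v⟫ - ⟪gradient f z, v⟫| ≤ M * t * ‖v‖ ^ 2 := by
    intro t ht
    rw [← inner_sub_left]
    refine (abs_real_inner_le_norm _ _).trans ?_
    have := hL _ (hmem t ht) z hz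
    rw [add_sub_cancel_left, norm_smul, Real.norm_of_nonneg ht.1] at this
    nlinarith [norm_nonneg v]
  have key : ∀ s : ℝ, |s| = 1 →
      s * (f w - f z - ⟪gradient f z, v⟫) ≤ M / 2 * ‖v‖ ^ 2 := by
    intro s hs
    set ψ : ℝ → ℝ := fun t => s * (f (z + t • v) - t * ⟪gradient f z, v⟫) - M / 2 * t ^ 2 * ‖v‖ ^ 2
    have hψ : ∀ t ∈ Set.Icc (0 : ℝ) 1, HasDerivAt ψ
        (s * (⟪gradient f (z + t • v), v⟫ - ⟪gradient f z, v⟫) - M * t * ‖v‖ ^ 2) t := by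
      intro t ht
      have h1 := (((hder t ht).sub ((hasDerivAt_id t).mul_const ⟪gradient f z, v⟫)).const_mul s).sub
        ((((hasDerivAt_id t).pow 2).const_mul (M / 2)).mul_const (‖v‖ ^ 2))
      refine HasDerivAt.congr_deriv (f := ψ) h1 ?_
      simp only [id, Nat.cast_ofNat]
      ring
    have hanti : AntitoneOn ψ (Set.Icc 0 1) := by
      refine antitoneOn_of_deriv_nonpos (convex_Icc 0 1)
        (fun t ht => (hψ t ht).continuousAt.continuousWithinAt)
        (fun t ht => (hψ t (interior_subset ht)).differentiableAt.differentiableWithinAt) ?_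
      intro t ht
      have ht' := interior_subset ht
      rw [(hψ t ht').deriv]
      have h1 := hbound t ht'
      have h2 := le_abs_self (s * (⟪gradient f (z + t • v), v⟫ - ⟪gradient f z, v⟫))
      rw [abs_mul, hs, one_mul] at h2
      linarith
    have := hanti (Set.left_mem_Icc.2 zero_le_one) (Set.right_mem_Icc.2 zero_le_one) zero_le_one
    simp only [ψ, hv, one_smul, zero_smul, add_zero, add_sub_cancel] at this
    rw [← hv] at this
    linarith
  rw [abs_le]
  constructor
  · linarith [key (-1) (by simp)]
  · linarith [key 1 (by simp)]

/-- Projected gradient descent for a strongly convex function converges linearly. -/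
theorem projectedGradient_linear [CompleteSpace E] {Y : Set E} (hne : Y.Nonempty)
    (hcl : IsClosed Y) (hcv : Convex ℝ Y) {φ : E → ℝ} {G : E → E} {ρ α : ℝ} (hρ : 0 ≤ ρ)
    (hα : 0 < α)
    (hup : ∀ y ∈ Y, ∀ w ∈ Y, φ w ≤ φ y + ⟪G y, w - y⟫ + (ρ + α) / 2 * ‖w - y‖ ^ 2)
    (hlow : ∀ y ∈ Y, ∀ w ∈ Y, φ y + ⟪G y, w - y⟫ + α / 2 * ‖w - y‖ ^ 2 ≤ φ w)
    {ystar : E} (hys : ystar ∈ Y) {u : ℕ → E} (hu0 : u 0 ∈ Y)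
    (hu : ∀ n, u (n + 1) = proj Y (u n - (2 / (ρ + 2 * α)) • G (u n))) (n : ℕ) :
    u n ∈ Y ∧ (1 + ρ / (2 * α)) * (φ (u n) - φ ystar) + (ρ / 4 + α / 2) * ‖ystar - u n‖ ^ 2 ≤
      (ρ / (ρ + 2 * α)) ^ n *
        ((1 + ρ / (2 * α)) * (φ (u 0) - φ ystar) + (ρ / 4 + α / 2) * ‖ystar - u 0‖ ^ 2) := by
  have hη : 0 < (ρ + 2 * α) / 2 := by positivity
  have hη' : 2 / (ρ + 2 * α) = 1 / ((ρ + 2 * α) / 2) := by rw [one_div_div]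
  have hmem : ∀ n, u n ∈ Y := by
    intro n
    cases n with
    | zero => exact hu0
    | succ n => rw [hu]; exact (proj_spec hne hcl hcv _).1
  refine ⟨hmem n, ?_⟩
  induction n with
  | zero => simp
  | succ n ih =>
    have hstep := hu n
    have h1 := fun w (hw : w ∈ Y) => proj_step_inner_le hne hcl hcv hη (u n) (G (u n)) hw
    rw [hη'] at hstep
    rw [← hstep] at h1
    have h2 := h1 ystar hys
    have h3 := h1 (u n) (hmem n)
    have h4 := hup (u n) (hmem n) (u (n + 1)) (hmem (n + 1))
    have h5 := hlow (u n) (hmem n) ystar hys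
    rw [sub_self, norm_zero, norm_sub_rev (u n)] at h3
    have e : ⟪G (u n), u (n + 1) - ystar⟫ = ⟪G (u n), u (n + 1) - u n⟫ - ⟪G (u n), ystar - u n⟫ := by
      rw [← inner_sub_right]; congr 1; abel
    rw [e] at h2
    set a := ‖ystar - u n‖ ^ 2
    set b := ‖ystar - u (n + 1)‖ ^ 2
    set m := ‖u (n + 1) - u n‖ ^ 2
    set c := ρ / (2 * α) with hc
    have hc0 : 0 ≤ c := by positivity
    have hcρ : c * α = ρ / 2 := by rw [hc]; field_simp
    have hdec : α / 2 * m ≤ φ (u n) - φ (u (n + 1)) := by nlinarith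
    have hdec' : ρ / 4 * m ≤ c * (φ (u n) - φ (u (n + 1))) := by
      have := mul_le_mul_of_nonneg_left hdec hc0
      have e' : c * (α / 2 * m) = ρ / 4 * m := by linear_combination m / 2 * hcρ
      linarith
    have hq : (1 + c) * (ρ / (ρ + 2 * α)) = c := by rw [hc]; field_simp; ring
    have hq2 : (ρ / 4 + α / 2) * (ρ / (ρ + 2 * α)) = ρ / 4 := by field_simp; ring
    have hq0 : 0 ≤ ρ / (ρ + 2 * α) := by positivity
    calc (1 + c) * (φ (u (n + 1)) - φ ystar) + (ρ / 4 + α / 2) * b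
        ≤ c * (φ (u n) - φ ystar) + ρ / 4 * a := by nlinarith
      _ = ρ / (ρ + 2 * α) * ((1 + c) * (φ (u n) - φ ystar) + (ρ / 4 + α / 2) * a) := by
          linear_combination (-(φ (u n) - φ ystar)) * hq - a * hq2
      _ ≤ _ := by
          rw [pow_succ', mul_assoc]
          exact mul_le_mul_of_nonneg_left ih hq0

end Hilbert

section PrimalDual

variable {E : Type*} [NormedAddCommGroup E] [InnerProductSpace ℝ E]

/-- A smooth strongly convex objective `F` and a smooth convex constraint function `h` on `Z`, with
gradients `GF` and `Gh`. -/
structure ConvexProgram (Z : Set E) (F h : E → ℝ) (GF Gh : E → E) (ρf ρh L : ℝ) : Prop where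
  obj_le : ∀ z ∈ Z, ∀ w ∈ Z, F w ≤ F z + ⟪GF z, w - z⟫ + 3 * ρf / 2 * ‖w - z‖ ^ 2
  le_obj : ∀ z ∈ Z, ∀ w ∈ Z, F z + ⟪GF z, w - z⟫ + ρf / 2 * ‖w - z‖ ^ 2 ≤ F w
  constr_le : ∀ z ∈ Z, ∀ w ∈ Z, h w ≤ h z + ⟪Gh z, w - z⟫ + ρh * ‖w - z‖ ^ 2
  le_constr : ∀ z ∈ Z, ∀ w ∈ Z, h z + ⟪Gh z, w - z⟫ ≤ h w
  abs_constr_sub_le : ∀ z ∈ Z, ∀ w ∈ Z, |h w - h z| ≤ L * ‖w - z‖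

/-- Iterates of the accelerated primal-dual method with inexact constraint values `hh` and
gradients `gg`, described by the variational inequalities of its two projections. -/
structure PrimalDualRun (Z : Set E) (h : E → ℝ) (GF Gh : E → E) (B ε₁ ε₂ : ℝ)
    (η τ θ : ℕ → ℝ) (z : ℕ → E) (lam hh : ℕ → ℝ) (gg : ℕ → E) : Prop where
  mem : ∀ t, z t ∈ Z
  lam_mem : ∀ t, lam t ∈ Set.Icc 0 B
  value_err : ∀ t, |hh t - h (z t)| ≤ ε₁
  grad_err : ∀ t, ‖gg t - Gh (z t)‖ ≤ ε₂
  primal : ∀ t, ∀ w ∈ Z, ⟪GF (z t) + lam (t + 1) • gg t, z (t + 1) - w⟫ ≤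
    η t / 2 * (‖w - z t‖ ^ 2 - ‖w - z (t + 1)‖ ^ 2 - ‖z (t + 1) - z t‖ ^ 2)
  dual : ∀ t, ∀ l ∈ Set.Icc 0 B, (l - lam (t + 1)) * ((1 + θ t) * hh t - θ t * hh (t - 1)) ≤
    τ t / 2 * ((l - lam t) ^ 2 - (l - lam (t + 1)) ^ 2 - (lam (t + 1) - lam t) ^ 2)

variable {Z : Set E} {F h : E → ℝ} {GF Gh : E → E} {ρf ρh L B ε₁ ε₂ t₀ D : ℝ}
  {η τ θ γ : ℕ → ℝ} {z : ℕ → E} {lam hh : ℕ → ℝ} {gg : ℕ → E}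

theorem PrimalDualRun.step (hC : ConvexProgram Z F h GF Gh ρf ρh L)
    (hR : PrimalDualRun Z h GF Gh B ε₁ ε₂ η τ θ z lam hh gg)
    (hρf : 0 < ρf) (hρh : 0 ≤ ρh) (ht₀ : t₀ * ρf = 6 * ρf + 4 * B * ρh) (ht₀' : 0 ≤ t₀)
    (hη : ∀ t, η t = ρf * (t + t₀ + 1) / 2) (hθ : ∀ t, θ t = (t + t₀) / (t + t₀ + 1))
    (hD : ∀ z ∈ Z, ∀ w ∈ Z, ‖w - z‖ ≤ D) {w : E} (hw : w ∈ Z) (hhw : h w ≤ 0)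
    {l : ℝ} (hl : l ∈ Set.Icc 0 B) (t : ℕ) :
    (t + t₀ + 1) * (F (z (t + 1)) + l * h (z (t + 1)) - F w) ≤
      ρf / 4 * ((t + t₀) ^ 2 * ‖w - z t‖ ^ 2 - (t + t₀ + 1) ^ 2 * ‖w - z (t + 1)‖ ^ 2)
      - (t + t₀ + 1) * (ρf * (t + 1) / 4) * ‖z (t + 1) - z t‖ ^ 2
      + (t + t₀ + 1) * τ t / 2
        * ((l - lam t) ^ 2 - (l - lam (t + 1)) ^ 2 - (lam (t + 1) - lam t) ^ 2)
      + (t + t₀ + 1) * ((l - lam (t + 1)) * (hh (t + 1) - hh t))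
      - (t + t₀) * ((l - lam (t + 1)) * (hh t - hh (t - 1)))
      + (t + t₀ + 1) * (B * ε₂ * D + B * ε₁) := by
  have hs : (0 : ℝ) < t + t₀ + 1 := by positivity
  have hz := hR.mem t
  have hz' := hR.mem (t + 1)
  have hl' := hR.lam_mem (t + 1)
  have hB : 0 ≤ B := hl.1.trans hl.2
  have hp := hR.primal t w hw
  have hd := hR.dual t l hl
  have f1 := hC.obj_le _ hz _ hz'
  have f2 := hC.le_obj _ hz _ hw
  have c1 := hC.constr_le _ hz _ hz'
  have c2 := hC.le_constr _ hz _ hw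
  have eF : ⟪GF (z t), z (t + 1) - z t⟫ - ⟪GF (z t), w - z t⟫ = ⟪GF (z t), z (t + 1) - w⟫ := by
    rw [← inner_sub_right]; congr 1; abel
  have eh : ⟪Gh (z t), z (t + 1) - z t⟫ - ⟪Gh (z t), w - z t⟫ = ⟪Gh (z t), z (t + 1) - w⟫ := by
    rw [← inner_sub_right]; congr 1; abel
  have ep : ⟪GF (z t) + lam (t + 1) • gg t, z (t + 1) - w⟫ = ⟪GF (z t), z (t + 1) - w⟫
      + lam (t + 1) * ⟪Gh (z t), z (t + 1) - w⟫
      + lam (t + 1) * ⟪gg t - Gh (z t), z (t + 1) - w⟫ := by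
    rw [inner_add_left, real_inner_smul_left, inner_sub_left]; ring
  have hε₂ : 0 ≤ ε₂ := (norm_nonneg _).trans (hR.grad_err t)
  have hε₁ : 0 ≤ ε₁ := (abs_nonneg _).trans (hR.value_err t)
  have herr : -(B * ε₂ * D) ≤ lam (t + 1) * ⟪gg t - Gh (z t), z (t + 1) - w⟫ := by
    have h1 : |⟪gg t - Gh (z t), z (t + 1) - w⟫| ≤ ε₂ * D :=
      (abs_real_inner_le_norm _ _).trans
        (mul_le_mul (hR.grad_err t) (hD _ hw _ hz') (norm_nonneg _) hε₂)
    have h2 : |lam (t + 1) * ⟪gg t - Gh (z t), z (t + 1) - w⟫| ≤ B * (ε₂ * D) := by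
      rw [abs_mul, abs_of_nonneg hl'.1]
      exact mul_le_mul hl'.2 h1 (abs_nonneg _) hB
    have := neg_abs_le (lam (t + 1) * ⟪gg t - Gh (z t), z (t + 1) - w⟫)
    linarith
  have hverr : (l - lam (t + 1)) * (h (z (t + 1)) - hh (t + 1)) ≤ B * ε₁ := by
    refine (le_abs_self _).trans ?_
    rw [abs_mul, abs_sub_comm (h _)]
    refine mul_le_mul ?_ (hR.value_err _) (abs_nonneg _) hB
    rw [abs_le]; constructor <;> linarith [hl.1, hl.2, hl'.1, hl'.2]
  have hcon : lam (t + 1) * (h (z (t + 1)) - h w) ≤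
      lam (t + 1) * ⟪Gh (z t), z (t + 1) - w⟫ + B * ρh * ‖z (t + 1) - z t‖ ^ 2 := by
    have h1 : h (z (t + 1)) - h w ≤ ⟪Gh (z t), z (t + 1) - w⟫ + ρh * ‖z (t + 1) - z t‖ ^ 2 := by
      linarith
    have h2 := mul_le_mul_of_nonneg_left h1 hl'.1
    have h3 : lam (t + 1) * (ρh * ‖z (t + 1) - z t‖ ^ 2) ≤ B * (ρh * ‖z (t + 1) - z t‖ ^ 2) :=
      mul_le_mul_of_nonneg_right hl'.2 (by positivity)
    linarith
  have hw0 : lam (t + 1) * h w ≤ 0 := mul_nonpos_of_nonneg_of_nonpos hl'.1 hhw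
  rw [ep, hη] at hp
  set a := ‖w - z t‖ ^ 2
  set b := ‖w - z (t + 1)‖ ^ 2
  set m := ‖z (t + 1) - z t‖ ^ 2
  have ha : 0 ≤ a := by positivity
  have hm : 0 ≤ m := by positivity
  have hprim : F (z (t + 1)) + lam (t + 1) * h (z (t + 1)) - F w ≤
      ρf * (t + t₀ + 1) / 4 * (a - b) - ρf / 2 * a - ρf * (t + 1) / 4 * m + B * ε₂ * D := by
    have e : ρf * (t + t₀ + 1) / 4 * m =
        ρf * (t + 1) / 4 * m + 3 * ρf / 2 * m + B * ρh * m := by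
      linear_combination m / 4 * ht₀
    have e2 : ρf * (t + t₀ + 1) / 2 / 2 * (a - b - m) =
        ρf * (t + t₀ + 1) / 4 * (a - b) - ρf * (t + t₀ + 1) / 4 * m := by ring
    rw [e2, e] at hp
    linarith
  have hfull : F (z (t + 1)) + l * h (z (t + 1)) - F w ≤
      ρf * (t + t₀ + 1) / 4 * (a - b) - ρf / 2 * a - ρf * (t + 1) / 4 * m + B * ε₂ * D
      + τ t / 2 * ((l - lam t) ^ 2 - (l - lam (t + 1)) ^ 2 - (lam (t + 1) - lam t) ^ 2)
      + (l - lam (t + 1)) * (hh (t + 1) - hh t)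
      - θ t * ((l - lam (t + 1)) * (hh t - hh (t - 1))) + B * ε₁ := by
    linarith
  have hθs : (t + t₀ + 1) * θ t = t + t₀ := by rw [hθ]; field_simp
  have hmul := mul_le_mul_of_nonneg_left hfull hs.le
  have e3 : (t + t₀ + 1) * (θ t * ((l - lam (t + 1)) * (hh t - hh (t - 1)))) =
      (t + t₀) * ((l - lam (t + 1)) * (hh t - hh (t - 1))) := by rw [← mul_assoc, hθs]
  have e4 : (t + t₀ + 1) * (ρf * (t + t₀ + 1) / 4 * (a - b) - ρf / 2 * a) ≤
      ρf / 4 * ((t + t₀) ^ 2 * a - (t + t₀ + 1) ^ 2 * b) := by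
    have : 0 ≤ ρf / 4 * a := by positivity
    linarith
  linarith

theorem mul_le_young (L x y : ℝ) {r : ℝ} (hr : 0 < r) :
    y * (L * x) ≤ 4 * L ^ 2 / r / 2 * y ^ 2 + r / 4 * x ^ 2 := by
  have h1 : 0 ≤ (2 * (L * y) - r * x) ^ 2 / (4 * r) := by positivity
  have e : (2 * (L * y) - r * x) ^ 2 / (4 * r) = (L * y) ^ 2 / r - y * (L * x) + r / 4 * x ^ 2 := by
    field_simp; ring
  have e2 : 4 * L ^ 2 / r / 2 * y ^ 2 = 2 * ((L * y) ^ 2 / r) := by ring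
  have h2 : 0 ≤ (L * y) ^ 2 / r := by positivity
  linarith

theorem dual_weight_antitone {s a : ℝ} (hρf : 0 < ρf) (ha : 0 < a) (has : a ≤ s + 1) :
    (s + 2) * (4 * L ^ 2 / (ρf * (a + 1))) ≤ (s + 1) * (4 * L ^ 2 / (ρf * a)) := by
  have e1 : (s + 2) * (4 * L ^ 2 / (ρf * (a + 1))) = (s + 2) / (a + 1) * (4 * L ^ 2 / ρf) := by
    field_simp
  have e2 : (s + 1) * (4 * L ^ 2 / (ρf * a)) = (s + 1) / a * (4 * L ^ 2 / ρf) := by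
    field_simp
  rw [e1, e2]
  refine mul_le_mul_of_nonneg_right ?_ (by positivity)
  rw [div_le_div_iff₀ (by linarith) ha]
  linarith

/-- Ergodic gap bound for the accelerated primal-dual method: the initialization contributes a
constant, and the inexactness contributes in proportion to the total weight. -/
theorem PrimalDualRun.sum_gap_le (hC : ConvexProgram Z F h GF Gh ρf ρh L)
    (hR : PrimalDualRun Z h GF Gh B ε₁ ε₂ η τ θ z lam hh gg)
    (hρf : 0 < ρf) (hρh : 0 ≤ ρh) (hL0 : 0 < L)
    (ht₀ : t₀ * ρf = 6 * ρf + 4 * B * ρh) (ht₀' : 0 ≤ t₀)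
    (hγ : ∀ t, γ t = t + t₀ + 1)
    (hη : ∀ t, η t = ρf * (t + t₀ + 1) / 2) (hθ : ∀ t, θ t = (t + t₀) / (t + t₀ + 1))
    (hτ₀ : 0 < τ 0) (hτ : ∀ t, 1 ≤ t → τ t = 4 * L ^ 2 / (ρf * t))
    (hD : ∀ z ∈ Z, ∀ w ∈ Z, ‖w - z‖ ≤ D) {w : E} (hw : w ∈ Z) (hhw : h w ≤ 0)
    {l : ℝ} (hl : l ∈ Set.Icc 0 B) {T : ℕ} (hT : 1 ≤ T) :
    ∑ t ∈ Finset.range T, γ t * (F (z (t + 1)) + l * h (z (t + 1)) - F w) ≤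
      ρf / 4 * (t₀ + 1) ^ 2 * D ^ 2 + (t₀ + 1) * τ 0 / 2 * B ^ 2 + (t₀ + 2) * τ 1 / 2 * B ^ 2
        + (1 + t₀) * (B ^ 2 * L ^ 2 / ρf)
      + (∑ t ∈ Finset.range T, γ t) * (B * ε₂ * D + 5 * B * ε₁) := by
  have hB : 0 ≤ B := hl.1.trans hl.2
  have hε₁ : 0 ≤ ε₁ := (abs_nonneg _).trans (hR.value_err 0)
  have hε₂ : 0 ≤ ε₂ := (norm_nonneg _).trans (hR.grad_err 0)
  have hD0 : 0 ≤ D := (norm_nonneg _).trans (hD _ hw _ hw)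
  have habs : ∀ t, |l - lam t| ≤ B := fun t => by
    have := hR.lam_mem t
    rw [abs_le]; constructor <;> linarith [hl.1, hl.2, this.1, this.2]
  have hsq : ∀ t, (l - lam t) ^ 2 ≤ B ^ 2 := fun t => sq_le_sq' (abs_le.1 (habs t)).1
    (abs_le.1 (habs t)).2
  have hst := fun t => hR.step hC hρf hρh ht₀ ht₀' hη hθ hD hw hhw hl t
  have hdiff : ∀ t, |hh (t + 1) - hh t| ≤ L * ‖z (t + 1) - z t‖ + 2 * ε₁ := by
    intro t
    have h1 := abs_le.1 (hC.abs_constr_sub_le _ (hR.mem t) _ (hR.mem (t + 1)))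
    have h2 := abs_le.1 (hR.value_err t)
    have h3 := abs_le.1 (hR.value_err (t + 1))
    rw [abs_le]; constructor <;> linarith [h1.1, h1.2, h2.1, h2.2, h3.1, h3.2]
  have hκ1 : τ 1 = 4 * L ^ 2 / ρf := by rw [hτ 1 le_rfl]; simp
  have key : ∀ T : ℕ,
      ∑ t ∈ Finset.range (T + 1), γ t * (F (z (t + 1)) + l * h (z (t + 1)) - F w) ≤
      ρf / 4 * (t₀ + 1) ^ 2 * D ^ 2 + (t₀ + 1) * τ 0 / 2 * B ^ 2 + (t₀ + 2) * τ 1 / 2 * B ^ 2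
      + (∑ t ∈ Finset.range (T + 1), γ t) * (B * ε₂ * D + 3 * B * ε₁)
      - ρf / 4 * (T + t₀ + 1) ^ 2 * ‖w - z (T + 1)‖ ^ 2
      - (T + t₀ + 2) * τ (T + 1) / 2 * (l - lam (T + 1)) ^ 2
      + (T + t₀ + 1) * ((l - lam (T + 1)) * (hh (T + 1) - hh T))
      - (T + t₀ + 1) * (ρf * (T + 1) / 4) * ‖z (T + 1) - z T‖ ^ 2 := by
    intro T
    induction T with
    | zero =>
      have h0 := hst 0
      simp only [zero_add, Finset.range_one, Finset.sum_singleton, hγ, Nat.cast_zero,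
        Nat.zero_sub, sub_self, mul_zero, sub_zero] at h0 ⊢
      have hd : ‖w - z 0‖ ^ 2 ≤ D ^ 2 :=
        pow_le_pow_left₀ (norm_nonneg _) (hD _ (hR.mem 0) _ hw) 2
      have h1 : ρf / 4 * (t₀ ^ 2 * ‖w - z 0‖ ^ 2) ≤ ρf / 4 * ((t₀ + 1) ^ 2 * D ^ 2) := by
        gcongr; linarith
      have h2 : (t₀ + 1) * τ 0 / 2 * (l - lam 0) ^ 2 ≤ (t₀ + 1) * τ 0 / 2 * B ^ 2 := by
        exact mul_le_mul_of_nonneg_left (hsq 0) (by positivity)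
      have hτ1 : 0 ≤ τ 1 := by rw [hκ1]; positivity
      have h3 : (t₀ + 2) * τ 1 / 2 * (l - lam 1) ^ 2 ≤ (t₀ + 2) * τ 1 / 2 * B ^ 2 := by
        exact mul_le_mul_of_nonneg_left (hsq 1) (by positivity)
      have h4 : 0 ≤ (t₀ + 1) * τ 0 / 2 * (l - lam 1) ^ 2 := by positivity
      have h5 : 0 ≤ (t₀ + 1) * τ 0 / 2 * (lam 1 - lam 0) ^ 2 := by positivity
      have h6 : 0 ≤ (t₀ + 1) * (2 * B * ε₁) := by positivity
      linarith
    | succ T ih =>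
      rw [Finset.sum_range_succ, Finset.sum_range_succ γ]
      have h0 := hst (T + 1)
      rw [← hγ (T + 1)] at h0
      simp only [Nat.add_sub_cancel] at h0
      push_cast at h0 ih ⊢
      set S := ∑ t ∈ Finset.range (T + 1), γ t * (F (z (t + 1)) + l * h (z (t + 1)) - F w)
      set Γ := ∑ t ∈ Finset.range (T + 1), γ t
      set s : ℝ := T + 1 + t₀ with hs
      have hs0 : 0 < s := by positivity
      have es : (T : ℝ) + t₀ + 1 = s := by rw [hs]; ring
      have es2 : (T : ℝ) + t₀ + 2 = s + 1 := by rw [hs]; ring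
      have hγs : γ (T + 1) = s + 1 := by rw [hγ]; push_cast; ring
      have es3 : (T : ℝ) + 1 + t₀ + 2 = s + 2 := by rw [hs]
      rw [es, es2] at ih
      rw [hγs] at h0 ⊢
      have hτT : τ (T + 1) = 4 * L ^ 2 / (ρf * (T + 1)) := by
        rw [hτ (T + 1) (by omega)]; push_cast; rfl
      have hτT' : τ (T + 1 + 1) = 4 * L ^ 2 / (ρf * (T + 1 + 1)) := by
        rw [hτ (T + 1 + 1) (by omega)]; push_cast; rfl
      have hT0 : (0 : ℝ) < T + 1 := by positivity
      -- the dual weights `γ t * τ t` do not increase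
      have hmono : (s + 2) * τ (T + 1 + 1) ≤ (s + 1) * τ (T + 1) := by
        rw [hτT, hτT']
        exact dual_weight_antitone hρf hT0 (by rw [hs]; linarith)
      have hdual : (s + 2) * τ (T + 1 + 1) / 2 * (l - lam (T + 1 + 1)) ^ 2 ≤
          (s + 1) * τ (T + 1) / 2 * (l - lam (T + 1 + 1)) ^ 2 := by
        have := mul_le_mul_of_nonneg_right hmono (sq_nonneg (l - lam (T + 1 + 1)))
        linarith
      -- the momentum term
      set x := ‖z (T + 1) - z T‖
      set y := |lam (T + 1 + 1) - lam (T + 1)|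
      have hcross : s * ((lam (T + 1 + 1) - lam (T + 1)) * (hh (T + 1) - hh T)) ≤
          (s + 1) * τ (T + 1) / 2 * (lam (T + 1 + 1) - lam (T + 1)) ^ 2
          + s * (ρf * (T + 1) / 4) * x ^ 2 + (s + 1) * (2 * B * ε₁) := by
        have hyB : y ≤ B := by
          have h1 := hR.lam_mem (T + 1)
          have h2 := hR.lam_mem (T + 1 + 1)
          rw [abs_le]; constructor <;> linarith [h1.1, h1.2, h2.1, h2.2]
        have h1 : (lam (T + 1 + 1) - lam (T + 1)) * (hh (T + 1) - hh T) ≤ y * (L * x + 2 * ε₁) := by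
          refine (le_abs_self _).trans ?_
          rw [abs_mul]
          exact mul_le_mul_of_nonneg_left (hdiff T) (abs_nonneg _)
        have h2 : y * (2 * ε₁) ≤ B * (2 * ε₁) := by gcongr
        rw [← sq_abs (lam (T + 1 + 1) - lam (T + 1))]
        change _ ≤ (s + 1) * τ (T + 1) / 2 * y ^ 2 + _ + _
        have h3 : s * τ (T + 1) / 2 * y ^ 2 ≤ (s + 1) * τ (T + 1) / 2 * y ^ 2 := by
          have : 0 ≤ τ (T + 1) := by rw [hτT]; positivity
          gcongr; linarith
        have h4 : y * (L * x) ≤ τ (T + 1) / 2 * y ^ 2 + ρf * (T + 1) / 4 * x ^ 2 := by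
          rw [hτT]
          exact mul_le_young L x y (by positivity)
        have h5 := mul_le_mul_of_nonneg_left (h1.trans (by linarith : _ ≤
          τ (T + 1) / 2 * y ^ 2 + ρf * (T + 1) / 4 * x ^ 2 + B * (2 * ε₁))) hs0.le
        have h6 : 0 ≤ B * (2 * ε₁) := by positivity
        linarith
      rw [es3]
      linarith
  obtain ⟨T, rfl⟩ : ∃ n, T = n + 1 := ⟨T - 1, by omega⟩
  refine (key T).trans ?_
  set Γ := ∑ t ∈ Finset.range (T + 1), γ t
  have hΓ : (T + t₀ + 1) ≤ Γ := by
    rw [← hγ T]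
    exact Finset.single_le_sum (f := γ) (fun i _ => by rw [hγ]; positivity)
      (Finset.mem_range.2 (Nat.lt_succ_self T))
  set x := ‖z (T + 1) - z T‖
  have hT0 : (0 : ℝ) < T + 1 := by positivity
  have h1 : (l - lam (T + 1)) * (hh (T + 1) - hh T) ≤ B * (L * x + 2 * ε₁) := by
    refine (le_abs_self _).trans ?_
    rw [abs_mul]
    exact mul_le_mul (habs _) (hdiff T) (abs_nonneg _) hB
  have h2 : B * (L * x) ≤ ρf * (T + 1) / 4 * x ^ 2 + B ^ 2 * L ^ 2 / (ρf * (T + 1)) := by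
    set r := ρf * ((T : ℝ) + 1)
    have hr : 0 < r := by positivity
    have : 0 ≤ (2 * (B * L) - r * x) ^ 2 / (4 * r) := by positivity
    have e2 : (2 * (B * L) - r * x) ^ 2 / (4 * r) =
        B ^ 2 * L ^ 2 / r - B * (L * x) + r / 4 * x ^ 2 := by
      field_simp; ring
    rw [e2] at this
    linarith
  have h3 : (T + t₀ + 1) * (B ^ 2 * L ^ 2 / (ρf * (T + 1))) ≤
      (1 + t₀) * (B ^ 2 * L ^ 2 / ρf) := by
    have e : (T + t₀ + 1) * (B ^ 2 * L ^ 2 / (ρf * (T + 1))) =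
        ((T + t₀ + 1) / (T + 1)) * (B ^ 2 * L ^ 2 / ρf) := by field_simp
    rw [e]
    have : (T + t₀ + 1) / ((T : ℝ) + 1) ≤ 1 + t₀ := by
      rw [div_le_iff₀ hT0]; nlinarith [(Nat.cast_nonneg T : (0 : ℝ) ≤ T)]
    gcongr
  have h4 : (T + t₀ + 1) * (2 * B * ε₁) ≤ Γ * (2 * B * ε₁) := by gcongr
  have h5 : 0 ≤ ρf / 4 * (T + t₀ + 1) ^ 2 * ‖w - z (T + 1)‖ ^ 2 := by positivity
  have h6 : 0 ≤ (T + t₀ + 2) * τ (T + 1) / 2 * (l - lam (T + 1)) ^ 2 := by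
    have : 0 ≤ τ (T + 1) := by rw [hτ _ (by omega)]; positivity
    positivity
  have hs0 : 0 ≤ (T : ℝ) + t₀ + 1 := by positivity
  have h7 := mul_le_mul_of_nonneg_left (h1.trans (by linarith : _ ≤
    ρf * (T + 1) / 4 * x ^ 2 + B ^ 2 * L ^ 2 / (ρf * (T + 1)) + 2 * B * ε₁)) hs0
  linarith

end PrimalDual

section Multiplier

variable {E : Type*} [NormedAddCommGroup E] [InnerProductSpace ℝ E]
  {Z : Set E} {F h : E → ℝ} {GF Gh : E → E} {ρf ρh L : ℝ}

theorem nonneg_of_forall_mul_add_sq_nonneg {a c : ℝ}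
    (h : ∀ s ∈ Set.Ioc (0 : ℝ) 1, 0 ≤ s * a + s ^ 2 * c) : 0 ≤ a := by
  by_contra! ha
  have hc : 0 < |c| + 1 := by positivity
  set s := min 1 (-a / (2 * (|c| + 1))) with hs
  have hs0 : 0 < s := lt_min one_pos (div_pos (by linarith) (by linarith))
  have h1 := h s ⟨hs0, min_le_left _ _⟩
  have h2 : s * (2 * (|c| + 1)) ≤ -a := by
    rw [← le_div_iff₀ (by positivity)]; exact min_le_right _ _
  have h3 : 0 ≤ a + s * c := by
    have : 0 ≤ s * (a + s * c) := by linarith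
    exact nonneg_of_mul_nonneg_right this hs0
  have h4 : s * c ≤ s * |c| := mul_le_mul_of_nonneg_left (le_abs_self c) hs0.le
  linarith [hs0]

/-- First-order optimality of a minimizer of the Lagrangian `F + lam * h`. -/
theorem ConvexProgram.inner_nonneg_of_isMinOn (hC : ConvexProgram Z F h GF Gh ρf ρh L)
    (hZ : Convex ℝ Z) {lam : ℝ} (hlam : 0 ≤ lam) {z : E} (hz : z ∈ Z)
    (hmin : ∀ w ∈ Z, F z + lam * h z ≤ F w + lam * h w) {w : E} (hw : w ∈ Z) :
    0 ≤ ⟪GF z + lam • Gh z, w - z⟫ := by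
  refine nonneg_of_forall_mul_add_sq_nonneg
    (c := 3 * ρf / 2 * ‖w - z‖ ^ 2 + lam * (ρh * ‖w - z‖ ^ 2)) fun s hs => ?_
  have hu : z + s • (w - z) ∈ Z := hZ.add_smul_sub_mem hz hw ⟨hs.1.le, hs.2⟩
  have h1 := hmin _ hu
  have h2 := hC.obj_le z hz _ hu
  have h3 := mul_le_mul_of_nonneg_left (hC.constr_le z hz _ hu) hlam
  rw [add_sub_cancel_left, norm_smul, mul_pow, Real.norm_eq_abs, sq_abs,
    real_inner_smul_right] at h2 h3
  rw [inner_add_left, real_inner_smul_left]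
  linarith

theorem ConvexProgram.lagrangian_growth (hC : ConvexProgram Z F h GF Gh ρf ρh L)
    {lam : ℝ} (hlam : 0 ≤ lam) {z : E} (hz : z ∈ Z)
    (hopt : ∀ w ∈ Z, 0 ≤ ⟪GF z + lam • Gh z, w - z⟫) {w : E} (hw : w ∈ Z) :
    F z + lam * h z + ρf / 2 * ‖w - z‖ ^ 2 ≤ F w + lam * h w := by
  have h1 := hC.le_obj z hz w hw
  have h2 := mul_le_mul_of_nonneg_left (hC.le_constr z hz w hw) hlam
  have h3 := hopt w hw
  rw [inner_add_left, real_inner_smul_left] at h3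
  linarith

/-- Under a Slater condition the convex program has a KKT pair with a bounded multiplier. -/
theorem ConvexProgram.exists_kkt (hC : ConvexProgram Z F h GF Gh ρf ρh L)
    (hZ : Convex ℝ Z) (hcomp : IsCompact Z) (hF : ContinuousOn F Z) (hh : ContinuousOn h Z)
    (hρf : 0 < ρf) (hL : 0 ≤ L) {s : E} (hs : s ∈ Z) {δ M B : ℝ} (hδ : 0 < δ) (hsδ : h s ≤ -δ)
    (hM : ∀ w ∈ Z, F s - F w ≤ M) (hB : M / δ + 1 ≤ B) :
    ∃ z ∈ Z, ∃ lam : ℝ, 0 ≤ lam ∧ lam ≤ B - 1 ∧ h z ≤ 0 ∧ lam * h z = 0 ∧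
      ∀ w ∈ Z, 0 ≤ ⟪GF z + lam • Gh z, w - z⟫ := by
  have hM0 : 0 ≤ M := by simpa using hM s hs
  have hB0 : 0 < B := by have : 0 ≤ M / δ := by positivity
                         linarith
  have hex : ∀ lam : ℝ, 0 ≤ lam → ∃ z ∈ Z, ∀ w ∈ Z, 0 ≤ ⟪GF z + lam • Gh z, w - z⟫ := by
    intro lam hlam
    obtain ⟨z, hz, hmin⟩ := hcomp.exists_isMinOn ⟨s, hs⟩
      (hF.add (continuousOn_const.mul hh) : ContinuousOn (fun z => F z + lam * h z) Z)
    exact ⟨z, hz, fun w hw => hC.inner_nonneg_of_isMinOn hZ hlam hz (fun w hw => hmin hw) hw⟩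
  choose! zf hzf hopt using hex
  have hBδ : M + δ ≤ B * δ := by
    have := mul_le_mul_of_nonneg_right hB hδ.le
    rwa [add_mul, div_mul_cancel₀ _ hδ.ne', one_mul] at this
  have main : ∃ lam : ℝ, 0 ≤ lam ∧ h (zf lam) ≤ 0 ∧ lam * h (zf lam) = 0 := by
    by_cases h0 : h (zf 0) ≤ 0
    · exact ⟨0, le_rfl, h0, zero_mul _⟩
    push Not at h0
    have hzB : h (zf B) ≤ 0 := by
      have h1 := hC.lagrangian_growth hB0.le (hzf B hB0.le) (hopt B hB0.le) hs
      have h2 := hM _ (hzf B hB0.le)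
      have h3 : B * h s ≤ B * -δ := mul_le_mul_of_nonneg_left hsδ hB0.le
      have h4 : 0 ≤ ρf / 2 * ‖s - zf B‖ ^ 2 := by positivity
      have h5 : B * h (zf B) ≤ 0 := by linarith
      exact nonpos_of_mul_nonpos_right h5 hB0
    have hlip : ∀ a ∈ Set.Icc 0 B, ∀ b ∈ Set.Icc 0 B,
        |h (zf a) - h (zf b)| ≤ L ^ 2 / ρf * |a - b| := by
      intro a ha b hb
      have h1 := hC.lagrangian_growth ha.1 (hzf a ha.1) (hopt a ha.1) (hzf b hb.1)
      have h2 := hC.lagrangian_growth hb.1 (hzf b hb.1) (hopt b hb.1) (hzf a ha.1)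
      have h3 := hC.abs_constr_sub_le _ (hzf b hb.1) _ (hzf a ha.1)
      rw [norm_sub_rev] at h1
      set x := ‖zf a - zf b‖
      have hx : 0 ≤ x := norm_nonneg _
      have h4 : ρf * x ^ 2 ≤ |a - b| * (L * x) := by
        have : (a - b) * (h (zf b) - h (zf a)) ≤ |a - b| * (L * x) := by
          refine (le_abs_self _).trans ?_
          rw [abs_mul, abs_sub_comm (h _)]
          exact mul_le_mul_of_nonneg_left h3 (abs_nonneg _)
        linarith
      have h5 : ρf * x ≤ |a - b| * L := by
        rcases hx.eq_or_lt with h0 | h0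
        · rw [← h0, mul_zero]; positivity
        · refine le_of_mul_le_mul_right ?_ h0
          linarith
      refine h3.trans ?_
      rw [div_mul_eq_mul_div, le_div_iff₀ hρf]
      nlinarith
    have hcont : ContinuousOn (fun lam => h (zf lam)) (Set.Icc 0 B) := by
      have : LipschitzOnWith (Real.toNNReal (L ^ 2 / ρf)) (fun lam => h (zf lam)) (Set.Icc 0 B) :=
        LipschitzOnWith.of_dist_le_mul fun a ha b hb => by
          rw [Real.dist_eq, Real.dist_eq, Real.coe_toNNReal _ (by positivity)]
          exact hlip a ha b hb
      exact this.continuousOn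
    obtain ⟨lam, hlam, hz⟩ := intermediate_value_Icc' hB0.le hcont ⟨hzB, h0.le⟩
    exact ⟨lam, hlam.1, le_of_eq hz, by simp only at hz; rw [hz, mul_zero]⟩
  obtain ⟨lam, hlam, hz0, hcs⟩ := main
  refine ⟨zf lam, hzf lam hlam, lam, hlam, ?_, hz0, hcs, hopt lam hlam⟩
  have h1 := hC.lagrangian_growth hlam (hzf lam hlam) (hopt lam hlam) hs
  have h2 := hM _ (hzf lam hlam)
  have h3 : lam * h s ≤ lam * -δ := mul_le_mul_of_nonneg_left hsδ hlam
  have h4 : 0 ≤ ρf / 2 * ‖s - zf lam‖ ^ 2 := by positivity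
  have h5 : lam ≤ M / δ := by rw [le_div_iff₀ hδ]; linarith
  linarith

/-- A primal point with small Lagrangian gap is nearly feasible, nearly optimal and close to the
solution. -/
theorem ConvexProgram.of_gap_le (hC : ConvexProgram Z F h GF Gh ρf ρh L) (hρf : 0 < ρf)
    {B e : ℝ} {z : E} (hz : z ∈ Z) {lam : ℝ} (hlam : 0 ≤ lam) (hlamB : lam ≤ B - 1)
    (hcs : lam * h z = 0) (hopt : ∀ w ∈ Z, 0 ≤ ⟪GF z + lam • Gh z, w - z⟫)
    {u : E} (hu : u ∈ Z) (hgap : ∀ l ∈ Set.Icc 0 B, F u + l * h u - F z ≤ e) :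
    h u ≤ e ∧ F u - F z ≤ e ∧ ‖z - u‖ ^ 2 ≤ 2 / ρf * e := by
  have h1 := hC.lagrangian_growth hlam hz hopt hu
  rw [hcs, norm_sub_rev] at h1
  have g0 := hgap 0 ⟨le_rfl, by linarith⟩
  have g1 := hgap lam ⟨hlam, by linarith⟩
  have g2 := hgap B ⟨by linarith, le_rfl⟩
  have hp : 0 ≤ ρf / 2 * ‖z - u‖ ^ 2 := by positivity
  refine ⟨?_, by linarith, ?_⟩
  · by_contra! hlt
    have he : 0 ≤ e := by linarith
    have h2 : 1 * h u ≤ (B - lam) * h u :=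
      mul_le_mul_of_nonneg_right (by linarith) (by linarith)
    linarith
  · rw [div_mul_eq_mul_div, le_div_iff₀ hρf]
    linarith

theorem sum_smul_div_mem {ι : Type*} (hZ : Convex ℝ Z) {s : Finset ι} {γ : ι → ℝ}
    (hγ : ∀ t ∈ s, 0 ≤ γ t) (hΓ : 0 < ∑ t ∈ s, γ t) {z : ι → E} (hz : ∀ t ∈ s, z t ∈ Z) :
    (1 / ∑ t ∈ s, γ t) • ∑ t ∈ s, γ t • z t ∈ Z := by
  rw [Finset.smul_sum]
  simp only [smul_smul]
  refine hZ.sum_mem (fun t ht => mul_nonneg (by positivity) (hγ t ht)) ?_ hz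
  rw [← Finset.mul_sum, one_div_mul_cancel hΓ.ne']

theorem ConvexProgram.jensen {ι : Type*} (hC : ConvexProgram Z F h GF Gh ρf ρh L) (hρf : 0 ≤ ρf)
    (hZ : Convex ℝ Z) {s : Finset ι} {γ : ι → ℝ} (hγ : ∀ t ∈ s, 0 ≤ γ t)
    (hΓ : 0 < ∑ t ∈ s, γ t) {z : ι → E} (hz : ∀ t ∈ s, z t ∈ Z) {l : ℝ} (hl : 0 ≤ l) (c : ℝ) :
    (∑ t ∈ s, γ t) * (F ((1 / ∑ t ∈ s, γ t) • ∑ t ∈ s, γ t • z t)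
        + l * h ((1 / ∑ t ∈ s, γ t) • ∑ t ∈ s, γ t • z t) - c) ≤
      ∑ t ∈ s, γ t * (F (z t) + l * h (z t) - c) := by
  have hu := sum_smul_div_mem hZ hγ hΓ hz
  set u := (1 / ∑ t ∈ s, γ t) • ∑ t ∈ s, γ t • z t with hu_def
  have hlin : ∑ t ∈ s, γ t * ⟪GF u + l • Gh u, z t - u⟫ = 0 := by
    have h1 : ∑ t ∈ s, γ t • (z t - u) = 0 := by
      simp only [smul_sub, Finset.sum_sub_distrib, ← Finset.sum_smul]
      rw [hu_def, smul_smul, mul_one_div_cancel hΓ.ne', one_smul, sub_self]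
    simp only [← real_inner_smul_right]
    rw [← inner_sum, h1, inner_zero_right]
  rw [Finset.sum_mul]
  have : ∑ t ∈ s, γ t * (F u + l * h u - c) =
      ∑ t ∈ s, γ t * (F u + l * h u - c + ⟪GF u + l • Gh u, z t - u⟫) := by
    simp only [mul_add, Finset.sum_add_distrib, hlin, add_zero]
  rw [this]
  refine Finset.sum_le_sum fun t ht => mul_le_mul_of_nonneg_left ?_ (hγ t ht)
  have h1 := hC.le_obj u hu _ (hz t ht)
  have h2 := mul_le_mul_of_nonneg_left (hC.le_constr u hu _ (hz t ht)) hl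
  have h3 : 0 ≤ ρf / 2 * ‖z t - u‖ ^ 2 := by positivity
  rw [inner_add_left, real_inner_smul_left]
  linarith

end Multiplier

theorem ContDiffAt.continuousAt_norm_gradient {E : Type*} [NormedAddCommGroup E]
    [InnerProductSpace ℝ E] [CompleteSpace E] {f : E → ℝ} {z : E} (hf : ContDiffAt ℝ 1 f z) :
    ContinuousAt (fun z => ‖gradient f z‖) z := by
  have h1 : ContinuousAt (fderiv ℝ f) z := (hf.fderiv_right (m := 0) (by norm_num)).continuousAt
  refine h1.norm.congr (Filter.Eventually.of_forall fun w => ?_)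
  simp [gradient]

section Pair

variable {p d : ℕ}

@[simp] theorem pair_fst (x : Vec p) (y : Vec d) : (pair x y).fst = x := rfl

@[simp] theorem pair_snd (x : Vec p) (y : Vec d) : (pair x y).snd = y := rfl

theorem inner_pairSpace (a b : PairSpace p d) : ⟪a, b⟫ = ⟪a.fst, b.fst⟫ + ⟪a.snd, b.snd⟫ :=
  WithLp.prod_inner_apply a b

theorem norm_sq_pairSpace (a : PairSpace p d) : ‖a‖ ^ 2 = ‖a.fst‖ ^ 2 + ‖a.snd‖ ^ 2 :=
  WithLp.prod_norm_sq_eq_of_L2 a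

theorem norm_fst_le_norm (a : PairSpace p d) : ‖a.fst‖ ≤ ‖a‖ :=
  le_of_sq_le_sq (by rw [norm_sq_pairSpace]; nlinarith [sq_nonneg ‖a.snd‖]) (norm_nonneg _)

theorem norm_pair_zero_right (x : Vec p) : ‖(pair x 0 : PairSpace p d)‖ = ‖x‖ := by
  rw [← sq_eq_sq₀ (norm_nonneg _) (norm_nonneg _), norm_sq_pairSpace]
  simp

theorem norm_pair_zero_left (y : Vec d) : ‖(pair 0 y : PairSpace p d)‖ = ‖y‖ := by
  rw [← sq_eq_sq₀ (norm_nonneg _) (norm_nonneg _), norm_sq_pairSpace]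
  simp

theorem pair_sub_pair_left (x x' : Vec p) (y : Vec d) :
    pair x' y - pair x y = pair (x' - x) 0 := by
  rw [← sub_self y]; rfl

theorem pair_sub_pair_right (x : Vec p) (y y' : Vec d) :
    pair x y' - pair x y = pair 0 (y' - y) := by
  rw [← sub_self x]; rfl

theorem continuous_pair : Continuous fun q : Vec p × Vec d => pair q.1 q.2 := by
  unfold pair
  fun_prop

end Pair

namespace BilevelProblem

variable {p d : ℕ} {P : BilevelProblem p d} {ρf ρg : ℝ}

theorem pair_mem_Z {x : Vec p} {y : Vec d} (hx : x ∈ P.X) (hy : y ∈ P.Y) : pair x y ∈ P.Z :=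
  ⟨hx, hy⟩

theorem Setting.convex_Z (hP : P.Setting) : Convex ℝ P.Z := fun _ hz _ hw _ _ ha hb hab =>
  ⟨hP.X_convex hz.1 hw.1 ha hb hab, hP.Y_convex hz.2 hw.2 ha hb hab⟩

theorem Setting.isCompact_X (hP : P.Setting) : IsCompact P.X :=
  Metric.isCompact_of_isClosed_isBounded hP.X_closed hP.X_bounded

theorem Setting.isCompact_Y (hP : P.Setting) : IsCompact P.Y :=
  Metric.isCompact_of_isClosed_isBounded hP.Y_closed hP.Y_bounded

theorem Setting.isCompact_Z (hP : P.Setting) : IsCompact P.Z := by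
  have : P.Z = (fun q : Vec p × Vec d => pair q.1 q.2) '' (P.X ×ˢ P.Y) := by
    ext z
    exact ⟨fun hz => ⟨(z.fst, z.snd), hz, rfl⟩, by rintro ⟨q, hq, rfl⟩; exact hq⟩
  rw [this]
  exact (hP.isCompact_X.prod hP.isCompact_Y).image continuous_pair

theorem Setting.nonempty_Z (hP : P.Setting) : P.Z.Nonempty := by
  obtain ⟨x, hx⟩ := hP.X_nonempty
  obtain ⟨y, hy⟩ := hP.Y_nonempty
  exact ⟨pair x y, hx, hy⟩

theorem Setting.differentiableAt_f (hP : P.Setting) {z : PairSpace p d} (hz : z ∈ P.Z) :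
    DifferentiableAt ℝ P.f z :=
  (hP.f_contDiff z hz).differentiableAt one_ne_zero

theorem Setting.differentiableAt_g (hP : P.Setting) {z : PairSpace p d} (hz : z ∈ P.Z) :
    DifferentiableAt ℝ P.g z :=
  (hP.g_contDiff z hz).differentiableAt one_ne_zero

theorem Setting.norm_sub_le_diamZ (hP : P.Setting) {z w : PairSpace p d} (hz : z ∈ P.Z)
    (hw : w ∈ P.Z) : ‖w - z‖ ≤ P.diamZ := by
  rw [← dist_eq_norm]
  exact Metric.dist_le_diam_of_mem hP.isCompact_Z.isBounded hw hz

theorem Setting.sub_le_oscF (hP : P.Setting) {z w : PairSpace p d} (hz : z ∈ P.Z)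
    (hw : w ∈ P.Z) : P.f w - P.f z ≤ P.oscF := by
  have hcont : ContinuousOn P.f P.Z := fun z hz =>
    (hP.f_contDiff z hz).continuousAt.continuousWithinAt
  refine (le_abs_self _).trans ?_
  rw [← Real.dist_eq]
  exact Metric.dist_le_diam_of_mem (hP.isCompact_Z.image_of_continuousOn hcont).isBounded
    ⟨w, hw, rfl⟩ ⟨z, hz, rfl⟩

theorem Setting.norm_gradient_le_lipG (hP : P.Setting) {z : PairSpace p d} (hz : z ∈ P.Z) :
    ‖gradient P.g z‖ ≤ P.lipG := by
  have hcont : ContinuousOn (fun z => ‖gradient P.g z‖) P.Z := fun z hz =>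
    (hP.g_contDiff z hz).continuousAt_norm_gradient.continuousWithinAt
  exact le_csSup (hP.isCompact_Z.image_of_continuousOn hcont).bddAbove ⟨z, hz, rfl⟩

theorem abs_g_sub_le (hP : P.Setting) (hA : P.Assumption ρf ρg) {z w : PairSpace p d}
    (hz : z ∈ P.Z) (hw : w ∈ P.Z) :
    |P.g w - P.g z - ⟪gradient P.g z, w - z⟫| ≤ ρg / 2 * ‖w - z‖ ^ 2 :=
  abs_sub_linearization_le hP.convex_Z (fun _ h => hP.differentiableAt_g h) hA.g_lipschitz hz hw

theorem g_linearization_le (hA : P.Assumption ρf ρg) {z w : PairSpace p d}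
    (hz : z ∈ P.Z) (hw : w ∈ P.Z) :
    P.g z + ⟪gradient P.g z, w - z⟫ - ρg / 2 * ‖w.fst - z.fst‖ ^ 2 ≤ P.g w := by
  have := hA.g_lower z hz w hw
  rw [inner_pairSpace, norm_sub_rev]
  linarith! [this]

/-- The gradient of `g̃(x, ·)`. -/
def gradTildeY (P : BilevelProblem p d) (x : Vec p) (y : Vec d) : Vec d :=
  (gradient P.g (pair x y)).snd + P.α • y

theorem norm_sq_sub_expand {E : Type*} [NormedAddCommGroup E] [InnerProductSpace ℝ E] (y w : E) :
    ‖w‖ ^ 2 = ‖y‖ ^ 2 + 2 * ⟪y, w - y⟫ + ‖w - y‖ ^ 2 := by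
  have := norm_add_sq_real y (w - y)
  rwa [add_sub_cancel] at this

theorem gTilde_le (hP : P.Setting) (hA : P.Assumption ρf ρg) {x : Vec p} (hx : x ∈ P.X)
    {y w : Vec d} (hy : y ∈ P.Y) (hw : w ∈ P.Y) :
    P.gTilde x w ≤ P.gTilde x y + ⟪P.gradTildeY x y, w - y⟫ + (ρg + P.α) / 2 * ‖w - y‖ ^ 2 := by
  have h := (abs_le.1 (abs_g_sub_le hP hA (pair_mem_Z hx hy) (pair_mem_Z hx hw))).2
  rw [pair_sub_pair_right, norm_pair_zero_left, inner_pairSpace] at h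
  simp only [pair_fst, pair_snd, inner_zero_right, zero_add] at h
  unfold gTilde gradTildeY
  rw [inner_add_left, real_inner_smul_left, norm_sq_sub_expand y w]
  linarith

theorem le_gTilde (hA : P.Assumption ρf ρg) {x : Vec p} (hx : x ∈ P.X)
    {y w : Vec d} (hy : y ∈ P.Y) (hw : w ∈ P.Y) :
    P.gTilde x y + ⟪P.gradTildeY x y, w - y⟫ + P.α / 2 * ‖w - y‖ ^ 2 ≤ P.gTilde x w := by
  have h := g_linearization_le hA (pair_mem_Z hx hy) (pair_mem_Z hx hw)
  rw [pair_sub_pair_right, inner_pairSpace] at h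
  simp only [pair_fst, pair_snd, inner_zero_right, zero_add, sub_self, norm_zero] at h
  unfold gTilde gradTildeY
  rw [inner_add_left, real_inner_smul_left, norm_sq_sub_expand y w]
  linarith

/-- The minimizer of `g̃(x, ·)` over `Y`. -/
def yStar (P : BilevelProblem p d) (x : Vec p) : Vec d :=
  Classical.epsilon fun y => y ∈ P.Y ∧ ∀ w ∈ P.Y, P.gTilde x y ≤ P.gTilde x w

theorem Setting.yStar_spec (hP : P.Setting) {x : Vec p} (hx : x ∈ P.X) :
    P.yStar x ∈ P.Y ∧ ∀ w ∈ P.Y, P.gTilde x (P.yStar x) ≤ P.gTilde x w := by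
  have hcont : ContinuousOn (P.gTilde x) P.Y := by
    intro y hy
    have h1 := (hP.g_contDiff _ (pair_mem_Z hx hy)).continuousAt
    have h2 : ContinuousAt (fun y : Vec d => pair x y) y :=
      (continuous_pair.comp (Continuous.prodMk_right x)).continuousAt
    have h3 : ContinuousAt (fun y : Vec d => P.g (pair x y)) y := ContinuousAt.comp h1 h2
    exact (h3.add (by fun_prop)).continuousWithinAt
  obtain ⟨y, hy, hmin⟩ := hP.isCompact_Y.exists_isMinOn hP.Y_nonempty hcont
  exact Classical.epsilon_spec
    (p := fun y => y ∈ P.Y ∧ ∀ w ∈ P.Y, P.gTilde x y ≤ P.gTilde x w) ⟨y, hy, fun w hw => hmin hw⟩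

theorem Setting.gTildeStar_eq (hP : P.Setting) {x : Vec p} (hx : x ∈ P.X) :
    P.gTildeStar x = P.gTilde x (P.yStar x) := by
  have h := hP.yStar_spec hx
  refine IsLeast.csInf_eq ⟨⟨_, h.1, rfl⟩, ?_⟩
  rintro _ ⟨w, hw, rfl⟩
  exact h.2 w hw

theorem inner_gradTildeY_yStar_nonneg (hP : P.Setting) (hA : P.Assumption ρf ρg) {x : Vec p}
    (hx : x ∈ P.X) {w : Vec d} (hw : w ∈ P.Y) :
    0 ≤ ⟪P.gradTildeY x (P.yStar x), w - P.yStar x⟫ := by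
  obtain ⟨hy, hmin⟩ := hP.yStar_spec hx
  refine nonneg_of_forall_mul_add_sq_nonneg (c := (ρg + P.α) / 2 * ‖w - P.yStar x‖ ^ 2)
    fun s hs => ?_
  have hu : P.yStar x + s • (w - P.yStar x) ∈ P.Y :=
    hP.Y_convex.add_smul_sub_mem hy hw ⟨hs.1.le, hs.2⟩
  have h1 := hmin _ hu
  have h2 := gTilde_le hP hA hx hy hu
  rw [add_sub_cancel_left, norm_smul, mul_pow, Real.norm_eq_abs, sq_abs,
    real_inner_smul_right] at h2
  linarith

theorem gTildeStar_add_sq_le (hP : P.Setting) (hA : P.Assumption ρf ρg) {x : Vec p}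
    (hx : x ∈ P.X) {w : Vec d} (hw : w ∈ P.Y) :
    P.gTildeStar x + P.α / 2 * ‖w - P.yStar x‖ ^ 2 ≤ P.gTilde x w := by
  have h1 := inner_gradTildeY_yStar_nonneg hP hA hx hw
  have h2 := le_gTilde hA hx (hP.yStar_spec hx).1 hw
  rw [hP.gTildeStar_eq hx]
  linarith

/-- The gradient `∇ₓ g(x, y*(x))` of `g̃*`. -/
def gradStar (P : BilevelProblem p d) (x : Vec p) : Vec p :=
  (gradient P.g (pair x (P.yStar x))).fst

theorem abs_gTildeStar_sub_le (hP : P.Setting) (hA : P.Assumption ρf ρg) {x x' : Vec p}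
    (hx : x ∈ P.X) (hx' : x' ∈ P.X) :
    |P.gTildeStar x' - P.gTildeStar x - ⟪P.gradStar x, x' - x⟫| ≤ ρg / 2 * ‖x' - x‖ ^ 2 := by
  obtain ⟨hy, -⟩ := hP.yStar_spec hx
  obtain ⟨hy', hmin'⟩ := hP.yStar_spec hx'
  rw [abs_le, hP.gTildeStar_eq hx, hP.gTildeStar_eq hx']
  constructor
  · have h1 := g_linearization_le hA (pair_mem_Z hx hy) (pair_mem_Z hx' hy')
    have h2 := inner_gradTildeY_yStar_nonneg hP hA hx hy'
    have h3 := norm_sq_sub_expand (P.yStar x) (P.yStar x')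
    have h4 : 0 ≤ P.α * ‖P.yStar x' - P.yStar x‖ ^ 2 := by have := hP.α_pos; positivity
    rw [inner_pairSpace] at h1
    simp only [WithLp.sub_fst, WithLp.sub_snd, pair_fst, pair_snd] at h1
    unfold gradTildeY at h2
    rw [inner_add_left, real_inner_smul_left] at h2
    have h5 : P.α / 2 * ‖P.yStar x'‖ ^ 2 = P.α / 2 * ‖P.yStar x‖ ^ 2
      + P.α * ⟪P.yStar x, P.yStar x' - P.yStar x⟫
      + P.α / 2 * ‖P.yStar x' - P.yStar x‖ ^ 2 := by rw [h3]; ring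
    unfold gTilde gradStar
    linarith
  · have h1 := (abs_le.1 (abs_g_sub_le hP hA (pair_mem_Z hx hy) (pair_mem_Z hx' hy))).2
    have h2 := hmin' _ hy
    rw [pair_sub_pair_left, norm_pair_zero_right, inner_pairSpace] at h1
    simp only [pair_fst, pair_snd, inner_zero_right, add_zero] at h1
    unfold gTilde at h2 ⊢
    unfold gradStar
    linarith

/-- Danskin's theorem for `g̃*`, at the boundary points of `X` too. -/
theorem hasGradientAt_gTildeStar (hP : P.Setting) (hA : P.Assumption ρf ρg) {x₀ : Vec p}
    (hx₀ : x₀ ∈ P.X) : HasGradientAt P.gTildeStar (P.gradStar x₀) x₀ := by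
  obtain ⟨hy, -⟩ := hP.yStar_spec hx₀
  rw [hasGradientAt_iff_isLittleO, Asymptotics.isLittleO_iff]
  intro ε hε
  set y₀ := P.yStar x₀ with hy₀
  set G := P.gradStar x₀ with hG
  have hα := hP.α_pos
  have hstrict : HasStrictFDerivAt P.g (fderiv ℝ P.g (pair x₀ y₀)) (pair x₀ y₀) :=
    (hP.g_contDiff _ (pair_mem_Z hx₀ hy)).hasStrictFDerivAt one_ne_zero
  have htend : Filter.Tendsto (fun q : Vec p × Vec d => (pair q.1 q.2, pair x₀ q.2))
      (nhds (x₀, y₀)) (nhds (pair x₀ y₀, pair x₀ y₀)) := by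
    have hc : Continuous (fun q : Vec p × Vec d => (pair q.1 q.2, pair x₀ q.2)) :=
      continuous_pair.prodMk (continuous_pair.comp (continuous_const.prodMk continuous_snd))
    exact hc.tendsto (x₀, y₀)
  have hlocal : ∀ᶠ q : Vec p × Vec d in nhds (x₀, y₀),
      |P.g (pair q.1 q.2) - P.g (pair x₀ q.2) - ⟪G, q.1 - x₀⟫| ≤ ε * ‖q.1 - x₀‖ := by
    have h1 := htend.eventually (Asymptotics.isLittleO_iff.1 hstrict.isLittleO hε)
    filter_upwards [h1] with q hq
    rw [pair_sub_pair_left, norm_pair_zero_right, Real.norm_eq_abs] at hq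
    have e : fderiv ℝ P.g (pair x₀ y₀) (pair (q.1 - x₀) 0) = ⟪G, q.1 - x₀⟫ := by
      have h2 : fderiv ℝ P.g (pair x₀ y₀) (pair (q.1 - x₀) 0) =
          ⟪gradient P.g (pair x₀ y₀), pair (q.1 - x₀) 0⟫ := by simp [gradient]
      rw [h2, inner_pairSpace]
      simp [hG, gradStar, hy₀]
    rwa [e] at hq
  rw [nhds_prod_eq, Filter.eventually_prod_iff] at hlocal
  obtain ⟨pa, hpa, pb, hpb, hloc⟩ := hlocal
  obtain ⟨r, hr, hball⟩ := Metric.eventually_nhds_iff.1 hpb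
  have hunif : ∀ᶠ x in nhds x₀, ∀ y ∈ P.Y,
      |P.g (pair x y) - P.g (pair x₀ y)| < P.α * r ^ 2 / 4 := by
    refine hP.isCompact_Y.eventually_forall_of_forall_eventually fun y hyY => ?_
    have hg := (hP.g_contDiff _ (pair_mem_Z hx₀ hyY)).continuousAt
    have c1 : ContinuousAt (fun q : Vec p × Vec d => P.g (pair q.1 q.2)) (x₀, y) :=
      ContinuousAt.comp (g := P.g) (f := fun q : Vec p × Vec d => pair q.1 q.2) hg
        continuous_pair.continuousAt
    have c2 : ContinuousAt (fun q : Vec p × Vec d => P.g (pair x₀ q.2)) (x₀, y) :=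
      ContinuousAt.comp (g := P.g) (f := fun q : Vec p × Vec d => pair x₀ q.2) hg
        (continuous_pair.comp (continuous_const.prodMk continuous_snd)).continuousAt
    have c3 := (c1.sub c2).abs
    have : |P.g (pair x₀ y) - P.g (pair x₀ y)| < P.α * r ^ 2 / 4 := by
      rw [sub_self, abs_zero]; positivity
    exact c3.eventually (gt_mem_nhds this)
  have hsmall : ∀ᶠ x in nhds x₀, ‖G‖ * ‖x - x₀‖ < P.α * r ^ 2 / 4 := by
    have c : Continuous fun x => ‖G‖ * ‖x - x₀‖ := by fun_prop
    refine c.continuousAt.eventually (gt_mem_nhds ?_)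
    simp only [sub_self, norm_zero, mul_zero]; positivity
  filter_upwards [hpa, hunif, hsmall] with x hxa hxu hxs
  have hnear : ∀ y, dist y y₀ < r →
      |P.g (pair x y) - P.g (pair x₀ y) - ⟪G, x - x₀⟫| ≤ ε * ‖x - x₀‖ :=
    fun y hyr => hloc hxa (hball hyr)
  have hlow : ∀ y ∈ P.Y, P.gTildeStar x₀ + ⟪G, x - x₀⟫ - ε * ‖x - x₀‖ ≤ P.gTilde x y := by
    intro y hyY
    have hgrow := gTildeStar_add_sq_le hP hA hx₀ hyY
    unfold gTilde at hgrow ⊢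
    by_cases hyr : dist y y₀ < r
    · have h1 := (abs_le.1 (hnear y hyr)).1
      have h2 : 0 ≤ P.α / 2 * ‖y - P.yStar x₀‖ ^ 2 := by positivity
      linarith
    · push Not at hyr
      rw [dist_eq_norm] at hyr
      have h1 := (abs_lt.1 (hxu y hyY)).1
      have h2 : P.α / 2 * r ^ 2 ≤ P.α / 2 * ‖y - P.yStar x₀‖ ^ 2 := by gcongr
      have h3 := (real_inner_le_norm G (x - x₀)).trans hxs.le
      have h4 : 0 ≤ ε * ‖x - x₀‖ := by positivity
      linarith
  have hbdd : BddBelow (P.gTilde x '' P.Y) :=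
    ⟨P.gTildeStar x₀ + ⟪G, x - x₀⟫ - ε * ‖x - x₀‖, by rintro _ ⟨y, hy, rfl⟩; exact hlow y hy⟩
  have h1 : P.gTildeStar x₀ + ⟪G, x - x₀⟫ - ε * ‖x - x₀‖ ≤ P.gTildeStar x :=
    le_csInf (hP.Y_nonempty.image _) (by rintro _ ⟨y, hy, rfl⟩; exact hlow y hy)
  have h2 : P.gTildeStar x ≤ P.gTilde x y₀ := csInf_le hbdd ⟨y₀, hy, rfl⟩
  have h3 := (abs_le.1 (hnear y₀ (by simpa using hr))).2
  have h4 := hP.gTildeStar_eq hx₀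
  unfold gTilde at h2 h4
  rw [Real.norm_eq_abs, abs_le]
  constructor <;> linarith

theorem gradient_hTilde (hP : P.Setting) (hA : P.Assumption ρf ρg) {z : PairSpace p d}
    (hz : z ∈ P.Z) :
    gradient P.hTilde z = gradient P.g z - pair (P.gradStar z.fst) 0 := by
  have h1 := (hP.differentiableAt_g hz).hasGradientAt.hasFDerivAt
  have h2 := (hasGradientAt_gTildeStar hP hA hz.1).hasFDerivAt
  have h3 : HasFDerivAt (fun z : PairSpace p d => z.fst)
      (WithLp.fstL 2 ℝ (Vec p) (Vec d)) z :=
    (WithLp.fstL 2 ℝ (Vec p) (Vec d)).hasFDerivAt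
  have h4 := (h1.sub (h2.comp z h3)).sub_const P.δ
  refine HasGradientAt.gradient ?_
  rw [hasGradientAt_iff_hasFDerivAt]
  refine HasFDerivAt.congr_fderiv (f := P.hTilde) h4 ?_
  ext v
  simp

end BilevelProblem

namespace BilevelProblem

variable {p d : ℕ} {P : BilevelProblem p d} {ρf ρg : ℝ}

/-- The proximal objective `f + ρ_f ‖· - c‖²`. -/
def fProx (P : BilevelProblem p d) (ρf : ℝ) (c z : PairSpace p d) : ℝ :=
  P.f z + ρf * ‖z - c‖ ^ 2

/-- The proximal constraint function `h̃ + ρ ‖x - c_x‖²`. -/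
def hProx (P : BilevelProblem p d) (ρg : ℝ) (c z : PairSpace p d) : ℝ :=
  P.hTilde z + P.rho ρg * ‖z.fst - c.fst‖ ^ 2

/-- The gradient of the proximal constraint function. -/
def gradHProx (P : BilevelProblem p d) (ρg : ℝ) (c z : PairSpace p d) : PairSpace p d :=
  gradient P.g z - pair (P.gradStar z.fst) 0 + (2 * P.rho ρg) • pair (z.fst - c.fst) 0

theorem rhoH_eq (hα : 0 < P.α) : P.rhoH ρg = 2 * P.rho ρg := by
  unfold rhoH rho
  field_simp

theorem le_rho (hα : 0 < P.α) : ρg ≤ P.rho ρg := by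
  unfold rho
  rw [le_div_iff₀ (by positivity)]
  nlinarith [sq_nonneg ρg]

theorem norm_sq_sub_center {E : Type*} [NormedAddCommGroup E] [InnerProductSpace ℝ E]
    (c z w : E) : ‖w - c‖ ^ 2 = ‖z - c‖ ^ 2 + 2 * ⟪z - c, w - z⟫ + ‖w - z‖ ^ 2 := by
  have := norm_sq_sub_expand (z - c) (w - c)
  rwa [sub_sub_sub_cancel_right] at this

theorem inner_gradHProx (c z v : PairSpace p d) :
    ⟪P.gradHProx ρg c z, v⟫ = ⟪gradient P.g z, v⟫ - ⟪P.gradStar z.fst, v.fst⟫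
      + 2 * P.rho ρg * ⟪z.fst - c.fst, v.fst⟫ := by
  unfold gradHProx
  rw [inner_add_left, inner_sub_left, real_inner_smul_left, inner_pairSpace (pair _ _),
    inner_pairSpace (pair (z.fst - c.fst) _)]
  simp

theorem norm_gradHProx_le (hP : P.Setting) (hρg : 0 ≤ ρg) {c z : PairSpace p d} (hc : c ∈ P.Z)
    (hz : z ∈ P.Z) :
    ‖P.gradHProx ρg c z‖ ≤ 2 * P.lipG + P.rhoH ρg * P.diamZ := by
  have h1 := hP.norm_gradient_le_lipG hz
  have h2 : ‖(pair (P.gradStar z.fst) 0 : PairSpace p d)‖ ≤ P.lipG := by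
    rw [norm_pair_zero_right]
    exact (norm_fst_le_norm _).trans
      (hP.norm_gradient_le_lipG (pair_mem_Z hz.1 (hP.yStar_spec hz.1).1))
  have hρ : 0 ≤ P.rho ρg := hρg.trans (le_rho hP.α_pos)
  have h3 : ‖(2 * P.rho ρg) • (pair (z.fst - c.fst) 0 : PairSpace p d)‖ ≤
      P.rhoH ρg * P.diamZ := by
    rw [norm_smul, norm_pair_zero_right, rhoH_eq hP.α_pos, Real.norm_of_nonneg (by positivity)]
    exact mul_le_mul_of_nonneg_left
      ((norm_fst_le_norm (z - c)).trans (hP.norm_sub_le_diamZ hc hz)) (by positivity)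
  refine (norm_add_le _ _).trans ?_
  have h4 := norm_sub_le (gradient P.g z) (pair (P.gradStar z.fst) 0)
  linarith

theorem convexProgram_prox (hP : P.Setting) (hA : P.Assumption ρf ρg) (hρg : 0 ≤ ρg) {L : ℝ}
    (hL : 2 * P.lipG + P.rhoH ρg * P.diamZ ≤ L) {c : PairSpace p d} (hc : c ∈ P.Z) :
    ConvexProgram P.Z (P.fProx ρf c) (P.hProx ρg c) (P.gradFk ρf c) (P.gradHProx ρg c) ρf
      (P.rhoH ρg) L := by
  have hf := fun z (hz : z ∈ P.Z) w (hw : w ∈ P.Z) => abs_le.1 <|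
    abs_sub_linearization_le hP.convex_Z (fun _ h => hP.differentiableAt_f h) hA.f_lipschitz hz hw
  have hG : ∀ z w : PairSpace p d, ⟪P.gradFk ρf c z, w - z⟫ =
      ⟪gradient P.f z, w - z⟫ + 2 * ρf * ⟪z - c, w - z⟫ := fun z w => by
    unfold gradFk
    rw [inner_add_left, real_inner_smul_left]
  have hρ := le_rho (ρg := ρg) hP.α_pos
  have hlow : ∀ z ∈ P.Z, ∀ w ∈ P.Z,
      P.hProx ρg c z + ⟪P.gradHProx ρg c z, w - z⟫ ≤ P.hProx ρg c w := by
    intro z hz w hw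
    have h1 := g_linearization_le hA hz hw
    have h2 := (abs_le.1 (abs_gTildeStar_sub_le hP hA hz.1 hw.1)).2
    have h3 := norm_sq_sub_center c.fst z.fst w.fst
    have h4 : 0 ≤ (P.rho ρg - ρg) * ‖w.fst - z.fst‖ ^ 2 :=
      mul_nonneg (by linarith) (by positivity)
    rw [inner_gradHProx]
    unfold hProx hTilde
    rw [h3, WithLp.sub_fst]
    linarith
  refine ⟨fun z hz w hw => ?_, fun z hz w hw => ?_, fun z hz w hw => ?_, hlow,
    fun z hz w hw => ?_⟩
  · have h1 := (hf z hz w hw).2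
    rw [hG]
    unfold fProx
    rw [norm_sq_sub_center c z w]
    linarith
  · have h1 := (hf z hz w hw).1
    rw [hG]
    unfold fProx
    rw [norm_sq_sub_center c z w]
    linarith
  · have h1 := (abs_le.1 (abs_g_sub_le hP hA hz hw)).2
    have h2 := (abs_le.1 (abs_gTildeStar_sub_le hP hA hz.1 hw.1)).1
    have h3 := norm_sq_sub_center c.fst z.fst w.fst
    have h4 : ‖w.fst - z.fst‖ ^ 2 ≤ ‖w - z‖ ^ 2 :=
      pow_le_pow_left₀ (norm_nonneg _) (norm_fst_le_norm (w - z)) 2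
    have h5 := mul_le_mul_of_nonneg_left h4 (by linarith : 0 ≤ ρg / 2 + P.rho ρg)
    have h6 : 0 ≤ (P.rho ρg - ρg) * ‖w - z‖ ^ 2 := mul_nonneg (by linarith) (by positivity)
    rw [inner_gradHProx, rhoH_eq hP.α_pos]
    unfold hProx hTilde
    rw [h3, WithLp.sub_fst]
    linarith
  · have key : ∀ z ∈ P.Z, ∀ w ∈ P.Z, P.hProx ρg c z - P.hProx ρg c w ≤ L * ‖w - z‖ := by
      intro z hz w hw
      have h1 := hlow z hz w hw
      have h2 := neg_le_of_abs_le (abs_real_inner_le_norm (P.gradHProx ρg c z) (w - z))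
      have h3 := mul_le_mul_of_nonneg_right ((norm_gradHProx_le hP hρg hc hz).trans hL)
        (norm_nonneg (w - z))
      linarith
    have h1 := key z hz w hw
    have h2 := key w hw z hz
    rw [norm_sub_rev] at h2
    rw [abs_le]
    constructor <;> linarith

theorem exists_prox_kkt (hP : P.Setting) (hA : P.Assumption ρf ρg) (hρf : 0 < ρf) (hρg : 0 ≤ ρg)
    {B L : ℝ} (hB : (P.oscF + ρf * P.diamZ ^ 2) / P.δ + 1 ≤ B) (hLpos : 0 < L)
    (hL : 2 * P.lipG + P.rhoH ρg * P.diamZ ≤ L) {c : PairSpace p d} (hc : c ∈ P.Z) :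
    ∃ z ∈ P.Z, ∃ lam : ℝ, 0 ≤ lam ∧ lam ≤ B - 1 ∧ P.hProx ρg c z ≤ 0 ∧
      lam * P.hProx ρg c z = 0 ∧
      ∀ w ∈ P.Z, 0 ≤ ⟪P.gradFk ρf c z + lam • P.gradHProx ρg c z, w - z⟫ := by
  have hC := convexProgram_prox hP hA hρg hL hc
  have hys := (hP.yStar_spec hc.1).1
  have hs : pair c.fst (P.yStar c.fst) ∈ P.Z := pair_mem_Z hc.1 hys
  have hF : ContinuousOn (P.fProx ρf c) P.Z := fun z hz => by
    have h1 := (hP.f_contDiff z hz).continuousAt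
    have h2 : Continuous fun z : PairSpace p d => ρf * ‖z - c‖ ^ 2 := by fun_prop
    exact (h1.add h2.continuousAt).continuousWithinAt
  have hh : ContinuousOn (P.hProx ρg c) P.Z := by
    have : LipschitzOnWith (Real.toNNReal L) (P.hProx ρg c) P.Z :=
      LipschitzOnWith.of_dist_le_mul fun z hz w hw => by
        rw [Real.dist_eq, dist_eq_norm, Real.coe_toNNReal _ hLpos.le]
        exact hC.abs_constr_sub_le w hw z hz
    exact this.continuousOn
  refine hC.exists_kkt hP.convex_Z hP.isCompact_Z hF hh hρf hLpos.le hs hP.δ_pos ?_ ?_ hB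
  · unfold hProx hTilde
    have h1 := hP.gTildeStar_eq hc.1
    have h2 : 0 ≤ P.α / 2 * ‖P.yStar c.fst‖ ^ 2 := by have := hP.α_pos; positivity
    unfold gTilde at h1
    simp only [pair_fst, sub_self, norm_zero]
    linarith
  · intro w hw
    unfold fProx
    have h1 := hP.sub_le_oscF hw hs
    have h2 : ‖pair c.fst (P.yStar c.fst) - c‖ ^ 2 ≤ P.diamZ ^ 2 :=
      pow_le_pow_left₀ (norm_nonneg _) (hP.norm_sub_le_diamZ hc hs) 2
    have h3 := mul_le_mul_of_nonneg_left h2 hρf.le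
    have h4 : 0 ≤ ρf * ‖w - c‖ ^ 2 := by positivity
    linarith

theorem rate_mem (hα : 0 < P.α) (hρg : 0 ≤ ρg) :
    0 ≤ 1 - P.α / (ρg + 2 * P.α) ∧ 1 - P.α / (ρg + 2 * P.α) ≤ 1 ∧
      ρg / (ρg + 2 * P.α) ≤ (1 - P.α / (ρg + 2 * P.α)) ^ 2 := by
  have h0 : 0 < ρg + 2 * P.α := by positivity
  have h1 : 0 ≤ P.α / (ρg + 2 * P.α) := by positivity
  have h2 : P.α / (ρg + 2 * P.α) ≤ 1 := by rw [div_le_one h0]; linarith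
  have h3 : ρg / (ρg + 2 * P.α) = 1 - 2 * (P.α / (ρg + 2 * P.α)) := by field_simp; ring
  refine ⟨by linarith, by linarith, ?_⟩
  rw [h3]
  nlinarith [sq_nonneg (P.α / (ρg + 2 * P.α))]

/-- Uniform linear convergence of the lower-level iteration, in value and in distance. -/
theorem exists_yHat_bound (hP : P.Setting) (hA : P.Assumption ρf ρg) (hρg : 0 ≤ ρg) :
    ∃ V : ℝ, 0 ≤ V ∧ ∀ x ∈ P.X, ∀ y₀ ∈ P.Y, ∀ n : ℕ, P.yHat ρg x y₀ n ∈ P.Y ∧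
      P.gTilde x (P.yHat ρg x y₀ n) - P.gTildeStar x ≤ V * (1 - P.α / (ρg + 2 * P.α)) ^ n ∧
      ‖P.yStar x - P.yHat ρg x y₀ n‖ ≤ V * (1 - P.α / (ρg + 2 * P.α)) ^ n := by
  have hα := hP.α_pos
  obtain ⟨M, hM⟩ := hP.isCompact_Z.exists_bound_of_continuousOn (f := P.g)
    fun z hz => (hP.g_contDiff z hz).continuousAt.continuousWithinAt
  obtain ⟨R, hR⟩ := hP.Y_bounded.exists_norm_le
  have hM0 : 0 ≤ M := by
    obtain ⟨z, hz⟩ := hP.nonempty_Z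
    exact (norm_nonneg _).trans (hM z hz)
  set k := ρg / 4 + P.α / 2 with hk
  have hk0 : 0 < k := by positivity
  set V := (1 + ρg / (2 * P.α)) * (2 * M + P.α / 2 * R ^ 2) + k * (2 * R) ^ 2 with hV
  have hV0 : 0 ≤ V := by positivity
  obtain ⟨hr0, hr1, hqr⟩ := rate_mem hα hρg
  set r := 1 - P.α / (ρg + 2 * P.α)
  set q := ρg / (ρg + 2 * P.α) with hq
  have hq0 : 0 ≤ q := by positivity
  refine ⟨V + √(V / k), by positivity, fun x hx y₀ hy₀ n => ?_⟩
  obtain ⟨hys, -⟩ := hP.yStar_spec hx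
  obtain ⟨hmem, hlin⟩ := projectedGradient_linear hP.Y_nonempty hP.Y_closed hP.Y_convex hρg hα
    (fun y hy w hw => gTilde_le hP hA hx hy hw) (fun y hy w hw => le_gTilde hA hx hy hw) hys
    (u := P.yHat ρg x y₀) hy₀ (fun n => rfl) n
  rw [← hP.gTildeStar_eq hx] at hlin
  set A := P.gTilde x (P.yHat ρg x y₀ n) - P.gTildeStar x with hAdef
  set b := ‖P.yStar x - P.yHat ρg x y₀ n‖
  have hA0 : 0 ≤ A := by
    have := gTildeStar_add_sq_le hP hA hx hmem
    have h2 : 0 ≤ P.α / 2 * ‖P.yHat ρg x y₀ n - P.yStar x‖ ^ 2 := by positivity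
    linarith
  have hinit : (1 + ρg / (2 * P.α)) * (P.gTilde x (P.yHat ρg x y₀ 0) - P.gTildeStar x)
      + k * ‖P.yStar x - P.yHat ρg x y₀ 0‖ ^ 2 ≤ V := by
    change (1 + ρg / (2 * P.α)) * (P.gTilde x y₀ - P.gTildeStar x)
      + k * ‖P.yStar x - y₀‖ ^ 2 ≤ V
    have h1 : P.gTilde x y₀ - P.gTildeStar x ≤ 2 * M + P.α / 2 * R ^ 2 := by
      rw [hP.gTildeStar_eq hx]
      have h1 := (abs_le.1 (hM _ (pair_mem_Z hx hy₀))).2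
      have h2 := (abs_le.1 (hM _ (pair_mem_Z hx hys))).1
      have h3 : ‖y₀‖ ^ 2 ≤ R ^ 2 := pow_le_pow_left₀ (norm_nonneg _) (hR _ hy₀) 2
      have h4 := mul_le_mul_of_nonneg_left h3 (by positivity : 0 ≤ P.α / 2)
      have h5 : 0 ≤ P.α / 2 * ‖P.yStar x‖ ^ 2 := by positivity
      unfold gTilde
      linarith
    have h2 : ‖P.yStar x - y₀‖ ^ 2 ≤ (2 * R) ^ 2 := by
      refine pow_le_pow_left₀ (norm_nonneg _) ?_ 2
      have := norm_sub_le (P.yStar x) y₀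
      linarith [hR _ hy₀, hR _ hys]
    have h3 : 0 ≤ 1 + ρg / (2 * P.α) := by positivity
    exact add_le_add (mul_le_mul_of_nonneg_left h1 h3) (mul_le_mul_of_nonneg_left h2 hk0.le)
  have hqn : q ^ n ≤ (r ^ n) ^ 2 := by
    rw [← pow_mul, mul_comm n 2, pow_mul]
    exact pow_le_pow_left₀ hq0 hqr n
  have hrn : (r ^ n) ^ 2 ≤ r ^ n := by
    have := pow_le_one₀ hr0 hr1 (n := n)
    have := pow_nonneg hr0 n
    nlinarith
  have hlin' : (1 + ρg / (2 * P.α)) * A + k * b ^ 2 ≤ q ^ n * V :=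
    hlin.trans (mul_le_mul_of_nonneg_left hinit (pow_nonneg hq0 n))
  have hrn0 : 0 ≤ r ^ n := pow_nonneg hr0 n
  refine ⟨hmem, ?_, ?_⟩
  · have h1 : 0 ≤ ρg / (2 * P.α) * A := by positivity
    have h2 : 0 ≤ k * b ^ 2 := by positivity
    have h3 : q ^ n * V ≤ r ^ n * V := mul_le_mul_of_nonneg_right (hqn.trans hrn) hV0
    have h4 : 0 ≤ √(V / k) * r ^ n := by positivity
    linarith
  · have h1 : 0 ≤ (1 + ρg / (2 * P.α)) * A := by positivity
    have h2 : k * b ^ 2 ≤ (r ^ n) ^ 2 * V :=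
      (by linarith : k * b ^ 2 ≤ q ^ n * V).trans (mul_le_mul_of_nonneg_right hqn hV0)
    have h3 : b ^ 2 ≤ (√(V / k) * r ^ n) ^ 2 := by
      rw [mul_pow, Real.sq_sqrt (by positivity), div_mul_eq_mul_div, le_div_iff₀ hk0]
      linarith
    have h4 := le_of_sq_le_sq h3 (by positivity)
    have h5 : 0 ≤ V * r ^ n := by positivity
    linarith

end BilevelProblem

namespace BilevelProblem

variable {p d : ℕ} {P : BilevelProblem p d} {ρf ρg : ℝ}

theorem innerLoop_z_mem (hP : P.Setting) (A : PDBOInput) {c : PairSpace p d} (hc : c ∈ P.Z)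
    (y₀ : ℕ → Vec d) (t : ℕ) : (P.innerLoop ρf ρg A c y₀ t).z ∈ P.Z := by
  cases t with
  | zero => exact hc
  | succ t => exact (proj_spec hP.nonempty_Z hP.isCompact_Z.isClosed hP.convex_Z _).1

theorem gradHHat_sub_gradHProx (c z : PairSpace p d) (y : Vec d) :
    P.gradHHat ρg c z y - P.gradHProx ρg c z =
      pair ((gradient P.g (pair z.fst (P.yStar z.fst))).fst
        - (gradient P.g (pair z.fst y)).fst) 0 := by
  rw [← pair_sub_pair_left _ _ 0]
  unfold gradHHat gradHProx gradStar
  abel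

theorem primalDualRun_innerLoop (hP : P.Setting) (hA : P.Assumption ρf ρg) (hρg : 0 ≤ ρg)
    {A : PDBOInput} (hB : 0 ≤ A.B) (hη : ∀ t, 0 < A.η t) (hτ : ∀ t, 0 < A.τ t)
    {c : PairSpace p d} (hc : c ∈ P.Z) {y₀ : ℕ → Vec d} {v : ℝ}
    (hy : ∀ x ∈ P.X, ∀ t, P.yHat ρg x (y₀ t) A.N ∈ P.Y ∧
      P.gTilde x (P.yHat ρg x (y₀ t) A.N) - P.gTildeStar x ≤ v ∧
      ‖P.yStar x - P.yHat ρg x (y₀ t) A.N‖ ≤ v) :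
    PrimalDualRun P.Z (P.hProx ρg c) (P.gradFk ρf c) (P.gradHProx ρg c) A.B v (ρg * v)
      A.η A.τ A.θ (fun t => (P.innerLoop ρf ρg A c y₀ t).z)
      (fun t => (P.innerLoop ρf ρg A c y₀ t).lam)
      (fun t => P.hHat ρg c (P.innerLoop ρf ρg A c y₀ t).z
        (P.yHat ρg (P.innerLoop ρf ρg A c y₀ t).z.fst (y₀ t) A.N))
      (fun t => P.gradHHat ρg c (P.innerLoop ρf ρg A c y₀ t).z
        (P.yHat ρg (P.innerLoop ρf ρg A c y₀ t).z.fst (y₀ t) A.N)) := by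
  have hmem := innerLoop_z_mem (ρf := ρf) (ρg := ρg) hP A hc y₀
  have hIcc : (Set.Icc 0 A.B).Nonempty := ⟨0, le_rfl, hB⟩
  refine ⟨hmem, fun t => ?_, fun t => ?_, fun t => ?_, fun t w hw => ?_, fun t l hl => ?_⟩
  · cases t with
    | zero => exact ⟨le_rfl, hB⟩
    | succ t => exact (proj_spec hIcc isClosed_Icc (convex_Icc 0 A.B) _).1
  · obtain ⟨h1, h2, -⟩ := hy _ (hmem t).1 t
    have h3 := gTildeStar_add_sq_le hP hA (hmem t).1 h1
    have h4 : 0 ≤ P.α / 2 * ‖P.yHat ρg (P.innerLoop ρf ρg A c y₀ t).z.fst (y₀ t) A.N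
      - P.yStar (P.innerLoop ρf ρg A c y₀ t).z.fst‖ ^ 2 := by have := hP.α_pos; positivity
    unfold hHat hProx hTilde
    rw [abs_le]
    constructor <;> linarith
  · obtain ⟨h1, -, h2⟩ := hy _ (hmem t).1 t
    have h3 := hA.g_lipschitz _ (pair_mem_Z (hmem t).1 (hP.yStar_spec (hmem t).1).1) _
      (pair_mem_Z (hmem t).1 h1)
    rw [gradHHat_sub_gradHProx, norm_pair_zero_right]
    rw [pair_sub_pair_right, norm_pair_zero_left] at h3
    exact (norm_fst_le_norm (_ - _ : PairSpace p d)).trans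
      (h3.trans (mul_le_mul_of_nonneg_left h2 hρg))
  · exact proj_step_inner_le hP.nonempty_Z hP.isCompact_Z.isClosed hP.convex_Z (hη t) _ _ hw
  · have hprev : (P.innerLoop ρf ρg A c y₀ t).hPrev =
        P.hHat ρg c (P.innerLoop ρf ρg A c y₀ (t - 1)).z
          (P.yHat ρg (P.innerLoop ρf ρg A c y₀ (t - 1)).z.fst (y₀ (t - 1)) A.N) := by
      cases t <;> rfl
    have h := proj_step_inner_le hIcc isClosed_Icc (convex_Icc 0 A.B) (hτ t)
      (P.innerLoop ρf ρg A c y₀ t).lam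
      (-((1 + A.θ t) * P.hHat ρg c (P.innerLoop ρf ρg A c y₀ t).z
        (P.yHat ρg (P.innerLoop ρf ρg A c y₀ t).z.fst (y₀ t) A.N)
        - A.θ t * (P.innerLoop ρf ρg A c y₀ t).hPrev)) hl
    rw [smul_neg, sub_neg_eq_add, smul_eq_mul] at h
    change ⟪_, (P.innerLoop ρf ρg A c y₀ (t + 1)).lam - l⟫ ≤ A.τ t / 2 * (_
      - ‖l - (P.innerLoop ρf ρg A c y₀ (t + 1)).lam‖ ^ 2
      - ‖(P.innerLoop ρf ρg A c y₀ (t + 1)).lam - _‖ ^ 2) at h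
    rw [hprev] at h
    simp only [Real.norm_eq_abs, sq_abs, RCLike.inner_apply, conj_trivial] at h
    linarith

theorem half_sq_le_sum_weights {γ : ℕ → ℝ} {t₀ : ℝ} (ht₀ : 0 ≤ t₀) (hγ : ∀ t, γ t = t + t₀ + 1)
    (T : ℕ) : (T : ℝ) ^ 2 / 2 ≤ ∑ t ∈ Finset.range T, γ t := by
  induction T with
  | zero => simp
  | succ T ih =>
    rw [Finset.sum_range_succ, hγ]
    push_cast
    linarith

/-- Each outer iteration solves its proximal subproblem up to an error `O(1/T² + r^N)`. -/
theorem exists_innerOutput_bound (hP : P.Setting) (hρf : 0 < ρf) (hρg : 0 ≤ ρg)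
    (hA : P.Assumption ρf ρg) {B L t₀ : ℝ}
    (hB : (P.oscF + ρf * P.diamZ ^ 2) / P.δ + 1 ≤ B)
    (hLpos : 0 < L) (hL : 2 * P.lipG + P.rhoH ρg * P.diamZ ≤ L)
    (ht₀ : t₀ = (6 * ρf + 4 * B * P.rhoH ρg) / ρf) {η τ θ γ : ℕ → ℝ}
    (hγ : ∀ t, γ t = t + t₀ + 1) (hη : ∀ t, η t = ρf * (t + t₀ + 1) / 2)
    (hθ : ∀ t, θ t = (t + t₀) / (t + t₀ + 1))
    (hτ₀ : 0 < τ 0) (hτ : ∀ t, 1 ≤ t → τ t = 4 * L ^ 2 / (ρf * t)) :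
    ∃ C : ℝ, 0 ≤ C ∧ ∀ T N : ℕ, 1 ≤ T → ∀ c ∈ P.Z, ∀ y₀ : ℕ → Vec d, (∀ t, y₀ t ∈ P.Y) →
      ∀ z ∈ P.Z, ∀ lam : ℝ, 0 ≤ lam → lam ≤ B - 1 → P.hProx ρg c z ≤ 0 →
      lam * P.hProx ρg c z = 0 →
      (∀ w ∈ P.Z, 0 ≤ ⟪P.gradFk ρf c z + lam • P.gradHProx ρg c z, w - z⟫) →
      ∀ u, u = P.innerOutput ρf ρg ⟨η, τ, θ, γ, B, T, N⟩ c y₀ →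
      ∀ e, e = C * (1 / (T : ℝ) ^ 2 + (1 - P.α / (ρg + 2 * P.α)) ^ N) →
      u ∈ P.Z ∧ P.hProx ρg c u ≤ e ∧ P.fProx ρf c u - P.fProx ρf c z ≤ e ∧
        ‖z - u‖ ^ 2 ≤ 2 / ρf * e := by
  have hosc : 0 ≤ P.oscF := Metric.diam_nonneg
  have hdiam : 0 ≤ P.diamZ := Metric.diam_nonneg
  have hδ := hP.δ_pos
  have hα := hP.α_pos
  have hB0 : 0 < B := by
    have : 0 ≤ (P.oscF + ρf * P.diamZ ^ 2) / P.δ := by positivity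
    linarith
  have hρh : 0 ≤ P.rhoH ρg := by unfold rhoH; positivity
  have ht₀' : 0 ≤ t₀ := by rw [ht₀]; positivity
  have ht₀ρ : t₀ * ρf = 6 * ρf + 4 * B * P.rhoH ρg := by rw [ht₀]; field_simp
  have hτpos : ∀ t, 0 < τ t := fun t => by
    rcases Nat.eq_zero_or_pos t with rfl | ht
    · exact hτ₀
    · rw [hτ t ht]
      have : (0 : ℝ) < t := by exact_mod_cast ht
      positivity
  have hηpos : ∀ t, 0 < η t := fun t => by rw [hη]; positivity
  have hτ1 := hτpos 1
  obtain ⟨V, hV0, hV⟩ := exists_yHat_bound hP hA hρg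
  obtain ⟨hr0, -, -⟩ := rate_mem hα hρg
  set r := 1 - P.α / (ρg + 2 * P.α)
  set C₀ := ρf / 4 * (t₀ + 1) ^ 2 * P.diamZ ^ 2 + (t₀ + 1) * τ 0 / 2 * B ^ 2
    + (t₀ + 2) * τ 1 / 2 * B ^ 2 + (1 + t₀) * (B ^ 2 * L ^ 2 / ρf) with hC₀
  have hC₀0 : 0 ≤ C₀ := by positivity
  set E₀ := B * (ρg * V) * P.diamZ + 5 * B * V with hE₀
  have hE₀0 : 0 ≤ E₀ := by positivity
  refine ⟨2 * C₀ + E₀, by positivity, ?_⟩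
  intro T N hT c hc y₀ hy₀ z hz lam hlam hlamB hhz hcs hopt u hu e he
  have hC := convexProgram_prox hP hA hρg hL hc
  have hR := primalDualRun_innerLoop (A := ⟨η, τ, θ, γ, B, T, N⟩) (v := V * r ^ N) hP hA hρg
    hB0.le hηpos hτpos hc (y₀ := y₀) (fun x hx t => hV x hx (y₀ t) (hy₀ t) N)
  set zz := fun t => (P.innerLoop ρf ρg ⟨η, τ, θ, γ, B, T, N⟩ c y₀ t).z with hzz
  have hγ0 : ∀ t ∈ Finset.range T, 0 ≤ γ t := fun t _ => by rw [hγ]; positivity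
  have hΓ := half_sq_le_sum_weights ht₀' hγ T
  have hT0 : (0 : ℝ) < T := by exact_mod_cast hT
  have hΓ0 : 0 < ∑ t ∈ Finset.range T, γ t := lt_of_lt_of_le (by positivity) hΓ
  have hzmem : ∀ t ∈ Finset.range T, zz (t + 1) ∈ P.Z := fun t _ => hR.mem (t + 1)
  have hu' : u = (1 / ∑ t ∈ Finset.range T, γ t) • ∑ t ∈ Finset.range T, γ t • zz (t + 1) := hu
  have humem : u ∈ P.Z := hu' ▸ sum_smul_div_mem hP.convex_Z hγ0 hΓ0 hzmem
  refine ⟨humem, hC.of_gap_le hρf hz hlam hlamB hcs hopt humem fun l hl => ?_⟩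
  have h1 := hC.jensen hρf.le hP.convex_Z hγ0 hΓ0 hzmem hl.1 (P.fProx ρf c z)
  rw [← hu'] at h1
  have h2 := hR.sum_gap_le hC hρf hρh hLpos ht₀ρ ht₀' hγ hη hθ hτ₀ hτ
    (fun z hz w hw => hP.norm_sub_le_diamZ hz hw) hz hhz hl hT
  have h3 := h1.trans h2
  set Γ := ∑ t ∈ Finset.range T, γ t
  set gap := P.fProx ρf c u + l * P.hProx ρg c u - P.fProx ρf c z
  have h4 : Γ * gap ≤ C₀ + Γ * (E₀ * r ^ N) := by
    rw [hE₀]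
    linarith
  have h5 : C₀ ≤ Γ * (2 * C₀ / (T : ℝ) ^ 2) := by
    have := mul_le_mul_of_nonneg_right hΓ (by positivity : 0 ≤ 2 * C₀ / (T : ℝ) ^ 2)
    have e1 : (T : ℝ) ^ 2 / 2 * (2 * C₀ / (T : ℝ) ^ 2) = C₀ := by field_simp
    linarith
  have h6 : gap ≤ 2 * C₀ / (T : ℝ) ^ 2 + E₀ * r ^ N := by
    refine le_of_mul_le_mul_left ?_ hΓ0
    linarith
  refine h6.trans ?_
  rw [he]
  have h7 : 0 ≤ 2 * C₀ * r ^ N := by positivity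
  have h8 : 0 ≤ E₀ * (1 / (T : ℝ) ^ 2) := by positivity
  have e2 : 2 * C₀ / (T : ℝ) ^ 2 = 2 * C₀ * (1 / (T : ℝ) ^ 2) := by ring
  linarith

end BilevelProblem

section Uniform

variable {Ω : Type*} [MeasurableSpace Ω] {μ : Measure Ω} [IsProbabilityMeasure μ] {khat : Ω → ℕ}
  {K : ℕ}

theorem ae_mem_Icc_of_uniform (hK : 1 ≤ K) (hm : Measurable khat)
    (hu : ∀ k ∈ Finset.Icc 1 K, μ {ω | khat ω = k} = 1 / (K : ENNReal)) :
    ∀ᵐ ω ∂μ, khat ω ∈ Finset.Icc 1 K := by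
  have hms : ∀ k, MeasurableSet {ω | khat ω = k} := fun k => hm (measurableSet_singleton k)
  have hset : {ω | khat ω ∈ Finset.Icc 1 K} = ⋃ k ∈ Finset.Icc 1 K, {ω | khat ω = k} := by
    ext ω; simp
  have hμ : μ {ω | khat ω ∈ Finset.Icc 1 K} = 1 := by
    rw [hset, measure_biUnion_finset (fun i _ j _ hij => Set.disjoint_left.2 fun ω hi hj =>
      hij (hi.symm.trans hj)) fun k _ => hms k, Finset.sum_congr rfl hu, Finset.sum_const,
      Nat.card_Icc, Nat.add_sub_cancel, nsmul_eq_mul]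
    exact ENNReal.mul_div_cancel (by exact_mod_cast (by omega : K ≠ 0)) (ENNReal.natCast_ne_top K)
  exact (prob_compl_eq_zero_iff (hm (Finset.measurableSet _))).2 hμ

/-- The expectation of a function of a uniform index is its average. -/
theorem integral_comp_uniform (hK : 1 ≤ K) (hm : Measurable khat)
    (hu : ∀ k ∈ Finset.Icc 1 K, μ {ω | khat ω = k} = 1 / (K : ENNReal)) (Q : ℕ → ℝ) :
    Integrable (fun ω => Q (khat ω)) μ ∧
      ∫ ω, Q (khat ω) ∂μ = (1 / (K : ℝ)) * ∑ k ∈ Finset.range K, Q (k + 1) := by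
  have hms : ∀ k, MeasurableSet {ω | khat ω = k} := fun k => hm (measurableSet_singleton k)
  have hae : (fun ω => ∑ k ∈ Finset.Icc 1 K, Set.indicator {ω | khat ω = k} (fun _ => Q k) ω)
      =ᵐ[μ] fun ω => Q (khat ω) := by
    filter_upwards [ae_mem_Icc_of_uniform hK hm hu] with ω hω
    rw [Finset.sum_eq_single_of_mem _ hω]
    · simp
    · intro k _ hk
      exact Set.indicator_of_notMem (fun h : khat ω = k => hk h.symm) _
  have hint : ∀ k, Integrable (Set.indicator {ω | khat ω = k} fun _ => Q k) μ := fun k =>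
    (integrable_const (Q k)).indicator (hms k)
  refine ⟨(integrable_finsetSum _ fun k _ => hint k).congr hae, ?_⟩
  rw [← integral_congr_ae hae, integral_finsetSum _ fun k _ => hint k, Finset.mul_sum,
    Finset.range_eq_Ico, Finset.sum_Ico_add' (fun k => 1 / (K : ℝ) * Q k) 0 K 1]
  refine Finset.sum_congr (by ext; simp) fun k hk => ?_
  rw [integral_indicator_const _ (hms k), smul_eq_mul, measureReal_def, hu k hk]
  simp

end Uniform

namespace BilevelProblem

variable {p d : ℕ} {P : BilevelProblem p d} {ρf ρg : ℝ}

/-- A KKT point of the proximal subproblem is an approximate KKT point of the original problem, with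
residuals controlled by the distance to the proximal center. -/
theorem kkt_residual_le (hP : P.Setting) (hA : P.Assumption ρf ρg) (hρf : 0 ≤ ρf) (hρg : 0 ≤ ρg)
    {B : ℝ} {c z : PairSpace p d} (hz : z ∈ P.Z) {lam : ℝ} (hlam : 0 ≤ lam) (hlamB : lam ≤ B)
    (hcs : lam * P.hProx ρg c z = 0)
    (hopt : ∀ w ∈ P.Z, 0 ≤ ⟪P.gradFk ρf c z + lam • P.gradHProx ρg c z, w - z⟫) :
    |lam * P.hTilde z| ≤ B * P.rho ρg * ‖z - c‖ ^ 2 ∧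
      Metric.infDist (gradient P.f z + lam • gradient P.hTilde z) (-normalCone P.Z z) ^ 2 ≤
        (2 * ρf + 2 * P.rho ρg * B) ^ 2 * ‖z - c‖ ^ 2 := by
  have hρ : 0 ≤ P.rho ρg := hρg.trans (le_rho hP.α_pos)
  have hB : 0 ≤ B := hlam.trans hlamB
  have hfst : ‖z.fst - c.fst‖ ≤ ‖z - c‖ := norm_fst_le_norm (z - c)
  constructor
  · have e : lam * P.hTilde z = -(lam * (P.rho ρg * ‖z.fst - c.fst‖ ^ 2)) := by
      unfold hProx at hcs
      linarith
    rw [e, abs_neg, abs_of_nonneg (by positivity), mul_assoc]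
    gcongr
  · rw [← mul_pow]
    refine pow_le_pow_left₀ Metric.infDist_nonneg ?_ 2
    have hmem : P.gradFk ρf c z + lam • P.gradHProx ρg c z ∈ -normalCone P.Z z := by
      rw [Set.mem_neg]
      intro w hw
      rw [inner_neg_left]
      linarith [hopt w hw]
    refine (Metric.infDist_le_dist_of_mem hmem).trans ?_
    have e : gradient P.f z + lam • gradient P.hTilde z
        - (P.gradFk ρf c z + lam • P.gradHProx ρg c z) =
        -((2 * ρf) • (z - c) + lam • (2 * P.rho ρg) • pair (z.fst - c.fst) 0) := by
      rw [gradient_hTilde hP hA hz]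
      unfold gradFk gradHProx
      rw [smul_add]
      abel
    rw [dist_eq_norm, e, norm_neg]
    refine (norm_add_le _ _).trans ?_
    rw [norm_smul, norm_smul, norm_smul, norm_pair_zero_right, Real.norm_of_nonneg hlam,
      Real.norm_of_nonneg (by positivity : 0 ≤ 2 * ρf),
      Real.norm_of_nonneg (by positivity : 0 ≤ 2 * P.rho ρg), add_mul]
    have h1 : lam * (2 * P.rho ρg * ‖z.fst - c.fst‖) ≤ B * (2 * P.rho ρg * ‖z - c‖) := by
      gcongr
    linarith

/-- One proximal step decreases `f`, up to the error with which it is solved. -/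
theorem prox_descent (hP : P.Setting) (hA : P.Assumption ρf ρg) (hρg : 0 ≤ ρg) {B L : ℝ}
    (hL : 2 * P.lipG + P.rhoH ρg * P.diamZ ≤ L) {c z u : PairSpace p d} (hc : c ∈ P.Z)
    (hz : z ∈ P.Z) {lam e : ℝ} (hlam : 0 ≤ lam) (hlamB : lam ≤ B) (he : 0 ≤ e)
    (hcs : lam * P.hProx ρg c z = 0)
    (hopt : ∀ w ∈ P.Z, 0 ≤ ⟪P.gradFk ρf c z + lam • P.gradHProx ρg c z, w - z⟫)
    (hce : P.hTilde c ≤ e) (hu : P.fProx ρf c u - P.fProx ρf c z ≤ e) (hρf : 0 ≤ ρf) :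
    P.f u + ρf / 2 * ‖z - c‖ ^ 2 ≤ P.f c + (B + 1) * e := by
  have h1 := (convexProgram_prox hP hA hρg hL hc).lagrangian_growth hlam hz hopt hc
  rw [hcs, norm_sub_rev] at h1
  have h2 : lam * P.hTilde c ≤ B * e :=
    (mul_le_mul_of_nonneg_left hce hlam).trans (mul_le_mul_of_nonneg_right hlamB he)
  have h3 : 0 ≤ ρf * ‖u - c‖ ^ 2 := by positivity
  unfold fProx at h1 hu
  unfold hProx at h1
  rw [sub_self, sub_self, norm_zero, norm_zero] at h1
  linarith

end BilevelProblem

theorem theorem2 {p d : ℕ} (P : BilevelProblem p d) (hP : P.Setting)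
    (ρf ρg : ℝ) (hρf : 0 < ρf) (hρg : 0 ≤ ρg) (hA : P.Assumption ρf ρg)
    (B L t₀ : ℝ)
    (hB : (P.oscF + ρf * P.diamZ ^ 2) / P.δ + 1 ≤ B)
    (hLpos : 0 < L) (hL : 2 * P.lipG + P.rhoH ρg * P.diamZ ≤ L)
    (ht₀ : t₀ = (6 * ρf + 4 * B * P.rhoH ρg) / ρf)
    (η τ θ γ : ℕ → ℝ)
    (hγ : ∀ t, γ t = t + t₀ + 1)
    (hη : ∀ t, η t = ρf * (t + t₀ + 1) / 2)
    (hθ : ∀ t, θ t = (t + t₀) / (t + t₀ + 1))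
    (hτ₀ : 0 < τ 0) (hτ : ∀ t, 1 ≤ t → τ t = 4 * L ^ 2 / (ρf * t)) :
    ∃ C : ℝ, ∀ K T N : ℕ, 1 ≤ K → 1 ≤ T →
      ∀ z0 ∈ P.Z, ∀ y0 : ℕ → ℕ → Vec d, (∀ k t, y0 k t ∈ P.Y) →
      ∀ (Ω : Type*) [MeasurableSpace Ω] (μ : Measure Ω) [IsProbabilityMeasure μ] (khat : Ω → ℕ),
        Measurable khat → (∀ k ∈ Finset.Icc 1 K, μ {ω | khat ω = k} = 1 / (K : ENNReal)) →
        P.IsStochasticKKT μ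
          (fun ω => P.proximalPDBO ρf ρg ⟨η, τ, θ, γ, B, T, N⟩ z0 y0 (khat ω))
          (C * (1 / K + 1 / T ^ 2 + (1 - P.α / (ρg + 2 * P.α)) ^ N)) := by
  obtain ⟨C₁, hC₁, hinner⟩ :=
    BilevelProblem.exists_innerOutput_bound hP hρf hρg hA hB hLpos hL ht₀ hγ hη hθ hτ₀ hτ
  have hkkt := fun c (hc : c ∈ P.Z) => BilevelProblem.exists_prox_kkt hP hA hρf hρg hB hLpos hL hc
  choose! zs hzs ls hls hlsB hfeas hcs hopt using hkkt
  have hosc : 0 ≤ P.oscF := Metric.diam_nonneg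
  have hdiam : 0 ≤ P.diamZ := Metric.diam_nonneg
  have hδ := hP.δ_pos
  have hB0 : 0 < B := by
    have : 0 ≤ (P.oscF + ρf * P.diamZ ^ 2) / P.δ := by positivity
    linarith
  have hρ : 0 ≤ P.rho ρg := hρg.trans (BilevelProblem.le_rho hP.α_pos)
  obtain ⟨hr0, -, -⟩ := BilevelProblem.rate_mem hP.α_pos hρg
  set r := 1 - P.α / (ρg + 2 * P.α)
  set M := B * P.rho ρg + (2 * ρf + 2 * P.rho ρg * B) ^ 2 with hM
  have hM0 : 0 ≤ M := by positivity
  set C₂ := P.diamZ ^ 2 + 2 / ρf * P.oscF with hC₂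
  have hC₂0 : 0 ≤ C₂ := by positivity
  set C₃ := 2 / ρf * (B + 1) with hC₃
  have hC₃0 : 0 ≤ C₃ := by positivity
  refine ⟨M * C₂ + (M * C₃ + 2 / ρf) * C₁, ?_⟩
  intro K T N hK hT z0 hz0 y0 hy0 Ω _ μ _ khat hkm hku
  set zt := P.proximalPDBO ρf ρg ⟨η, τ, θ, γ, B, T, N⟩ z0 y0 with hzt
  set S := 1 / (T : ℝ) ^ 2 + r ^ N with hS
  have hS0 : 0 ≤ S := by positivity
  set e := C₁ * S with he
  have he0 : 0 ≤ e := by positivity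
  have hsub : ∀ k, zt k ∈ P.Z → zt (k + 1) ∈ P.Z ∧ P.hProx ρg (zt k) (zt (k + 1)) ≤ e ∧
      P.fProx ρf (zt k) (zt (k + 1)) - P.fProx ρf (zt k) (zs (zt k)) ≤ e ∧
      ‖zs (zt k) - zt (k + 1)‖ ^ 2 ≤ 2 / ρf * e := fun k hk =>
    hinner T N hT (zt k) hk (y0 (k + 1)) (hy0 (k + 1)) _ (hzs _ hk) _ (hls _ hk) (hlsB _ hk)
      (hfeas _ hk) (hcs _ hk) (hopt _ hk) _ rfl e rfl
  have hmem : ∀ k, zt k ∈ P.Z := by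
    intro k
    induction k with
    | zero => exact hz0
    | succ k ih => exact (hsub k ih).1
  set a : ℕ → ℝ := fun k => ‖zs (zt k) - zt k‖ ^ 2 with ha
  have hlsB' : ∀ k, ls (zt k) ≤ B := fun k => by linarith [hlsB _ (hmem k)]
  have hdesc : ∀ k, P.f (zt (k + 2)) + ρf / 2 * a (k + 1) ≤ P.f (zt (k + 1)) + (B + 1) * e := by
    intro k
    have hk := hmem (k + 1)
    refine BilevelProblem.prox_descent hP hA hρg hL hk (hzs _ hk) (hls _ hk) (hlsB' _) he0
      (hcs _ hk) (hopt _ hk) ?_ (hsub _ hk).2.2.1 hρf.le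
    refine le_trans ?_ (hsub k (hmem k)).2.1
    unfold BilevelProblem.hProx
    exact le_add_of_nonneg_right (by positivity)
  have htel : ∀ n : ℕ, ρf / 2 * ∑ k ∈ Finset.range n, a (k + 1) + P.f (zt (n + 1)) ≤
      P.f (zt 1) + n * ((B + 1) * e) := by
    intro n
    induction n with
    | zero => simp
    | succ n ih =>
      rw [Finset.sum_range_succ]
      push_cast
      linarith [hdesc n]
  have hK0 : (0 : ℝ) < K := by exact_mod_cast hK
  have hsum : ∑ k ∈ Finset.range K, a k ≤ C₂ + K * (C₃ * e) := by
    obtain ⟨n, rfl⟩ : ∃ n, K = n + 1 := ⟨K - 1, by omega⟩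
    rw [Finset.sum_range_succ']
    have h1 := htel n
    have h2 := hP.sub_le_oscF (hmem (n + 1)) (hmem 1)
    have h3 : a 0 ≤ P.diamZ ^ 2 :=
      pow_le_pow_left₀ (norm_nonneg _) (hP.norm_sub_le_diamZ (hmem 0) (hzs _ (hmem 0))) 2
    have h4 : ∑ k ∈ Finset.range n, a (k + 1) ≤ 2 / ρf * (P.oscF + n * ((B + 1) * e)) := by
      rw [div_mul_eq_mul_div, le_div_iff₀ hρf]
      linarith
    have h5 : 0 ≤ C₃ * e := by positivity
    push_cast
    rw [hC₂]
    have e1 : 2 / ρf * (P.oscF + n * ((B + 1) * e)) = 2 / ρf * P.oscF + n * (C₃ * e) := by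
      rw [hC₃]; ring
    linarith
  have havg : ∀ Q : ℕ → ℝ, (∀ k, Q (k + 1) ≤ M * a k + 2 / ρf * e) →
      Integrable (fun ω => Q (khat ω)) μ ∧ ∫ ω, Q (khat ω) ∂μ ≤
        (M * C₂ + (M * C₃ + 2 / ρf) * C₁) * (1 / K + 1 / T ^ 2 + r ^ N) := by
    intro Q hQ
    obtain ⟨h1, h2⟩ := integral_comp_uniform hK hkm hku Q
    refine ⟨h1, h2.trans_le ?_⟩
    have h3 : ∑ k ∈ Finset.range K, Q (k + 1) ≤ M * (C₂ + K * (C₃ * e)) + K * (2 / ρf * e) := by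
      refine (Finset.sum_le_sum fun k _ => hQ k).trans ?_
      rw [Finset.sum_add_distrib, ← Finset.mul_sum, Finset.sum_const, Finset.card_range,
        nsmul_eq_mul]
      linarith [mul_le_mul_of_nonneg_left hsum hM0]
    have h4 := mul_le_mul_of_nonneg_left h3 (by positivity : 0 ≤ 1 / (K : ℝ))
    have e1 : 1 / (K : ℝ) * (M * (C₂ + K * (C₃ * e)) + K * (2 / ρf * e)) =
        M * C₂ * (1 / K) + (M * C₃ + 2 / ρf) * C₁ * S := by
      rw [he]; field_simp; ring
    have h5 : 0 ≤ M * C₂ * S := by positivity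
    have h6 : 0 ≤ (M * C₃ + 2 / ρf) * C₁ * (1 / K) := by positivity
    have e2 : 1 / (K : ℝ) + 1 / T ^ 2 + r ^ N = 1 / K + S := by rw [hS]; ring
    rw [e2]
    linarith
  have hres := fun k => BilevelProblem.kkt_residual_le hP hA hρf.le hρg (hzs _ (hmem k))
    (hls _ (hmem k)) (hlsB' k) (hcs _ (hmem k)) (hopt _ (hmem k))
  have he' : 0 ≤ 2 / ρf * e := by positivity
  refine ⟨Filter.Eventually.of_forall fun ω => hmem _, fun ω => zs (zt (khat ω - 1)),
    fun ω => ls (zt (khat ω - 1)),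
    (Measurable.of_discrete (f := fun k => zs (zt (k - 1)))).comp hkm,
    (Measurable.of_discrete (f := fun k => ls (zt (k - 1)))).comp hkm,
    Filter.Eventually.of_forall fun ω => ⟨hzs _ (hmem _), hls _ (hmem _), ?_⟩,
    havg (fun k => ‖zs (zt (k - 1)) - zt k‖ ^ 2) fun k => ?_,
    havg (fun k => |ls (zt (k - 1)) * P.hTilde (zs (zt (k - 1)))|) fun k => ?_,
    havg (fun k => Metric.infDist (gradient P.f (zs (zt (k - 1)))
      + ls (zt (k - 1)) • gradient P.hTilde (zs (zt (k - 1))))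
      (-normalCone P.Z (zs (zt (k - 1)))) ^ 2) fun k => ?_⟩
  · refine le_trans ?_ (hfeas _ (hmem (khat ω - 1)))
    unfold BilevelProblem.hProx
    exact le_add_of_nonneg_right (by positivity)
  · have h1 := (hsub k (hmem k)).2.2.2
    have h2 : 0 ≤ M * a k := by positivity
    simp only [Nat.add_sub_cancel]
    linarith
  · have h1 := (hres k).1
    have h2 : 0 ≤ (2 * ρf + 2 * P.rho ρg * B) ^ 2 * a k := by positivity
    simp only [Nat.add_sub_cancel]
    rw [hM]
    linarith
  · have h1 := (hres k).2
    have h2 : 0 ≤ B * P.rho ρg * a k := by positivity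
    simp only [Nat.add_sub_cancel]
    rw [hM]
    linarith

end
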